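/- Notation. For a Gaussian prime $\pi\nmid 2$ and $\alpha\in\mathbb Z[i]$ let $\left(\frac{\alpha}{\pi}\right)_4=0$ if $\pi\mid\alpha$, and otherwise let $\left(\frac{\alpha}{\pi}\right)_4$ be the unique element of $\{1,i,-1,-i\}$ congruent to $\alpha^{(N(\pi)-1)/4}$ modulo $\pi$, where $N(\pi)=\pi\bar\pi$. For $\beta\in\mathbb Z[i]$ prime to $2$ with prime factorization $\beta=\varepsilon\pi_1\cdots\pi_s$ ($\varepsilon$ a unit), the quartic Jacobi symbol is $\left(\frac{\alpha}{\beta}\right)_4=\prod_{j=1}^s\left(\frac{\alpha}{\pi_j}\right)_4$; for integers $u,v$ with $v$ prime to $\beta$ put $\left(\frac{u/v}{\beta}\right)_4=\left(\frac{u}{\beta}\right)_4\left(\frac{v}{\beta}\right)_4^{-1}$. Theorem 4.7. Let $p\equiv 1\pmod 8$ be a prime, and let $p=c^2+d^2=x^2+2(a^2+b^2)y^2$ with $a,b,c,d,x,y\in\mathbb Z$, $a\ne 0$, $2\mid a$, $(a,b)=1$, $c\equiv 1\pmod 4$, $d=2^rd_0$ with $r\ge 0$ and $d_0\equiv 1\pmod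 4$. Assume that $(c,x+d)=1$ or $(d_0,x+c)=1$, where $(m,n)$ denotes the greatest common divisor. Then for every $m\in\mathbb Z$, $$(-a^2-b^2)^{\frac{p-1}8}\equiv\begin{cases}(-1)^{\frac d4+\frac y2}\left(\frac cd\right)^m\pmod p&\text{if }4\mid a,\\[2pt](-1)^{\frac{b-1}2+\frac d4+\frac y2+\frac{x-1}2}\left(\frac cd\right)^{m-1}\pmod p&\text{if }4\mid a-2\end{cases}$$ if and only if $$\left(\frac{(ac+bd)/x}{b+ai}\right)_4=i^m.$$ Here $\frac cd$ is the quotient of $c$ by $d$ modulo $p$ (the hypotheses imply $p\nmid cd$, $4\mid d$, $2\mid y$, $2\nmid bx$ and that $x$ is prime to $a^2+b^2$). -/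

import Mathlib

/-- The quartic residue symbol `(α/π)₄` for a Gaussian prime `π` not dividing `2`:
it is `0` if `π ∣ α`, and otherwise it is the unique power `i ^ k` (`k = 0, 1, 2, 3`) with
`α ^ ((N π - 1) / 4) ≡ i ^ k (mod π)`.
(The last alternative is never reached for a prime `π` not dividing `2`.) -/
noncomputable def quarticResidueSymbol (α π : GaussianInt) : ℂ :=
  open Classical in
  if π ∣ α then 0
  else if π ∣ α ^ ((π.norm.natAbs - 1) / 4) - 1 then 1
  else if π ∣ α ^ ((π.norm.natAbs - 1) / 4) - ⟨0, 1⟩ then Complex.I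
  else if π ∣ α ^ ((π.norm.natAbs - 1) / 4) + 1 then -1
  else if π ∣ α ^ ((π.norm.natAbs - 1) / 4) + ⟨0, 1⟩ then -Complex.I
  else 0

/-- The quartic Jacobi symbol `(α/β)₄` for a nonzero Gaussian integer `β` prime to `2`:
the product of the quartic residue symbols `(α/π)₄` over the prime factors `π` of `β`, counted
with multiplicity. A prime factor may be replaced by an associate without changing the symbol,
so it does not matter whether primary primes are used; for a unit `β` the symbol is `1`. -/
noncomputable def quarticJacobiSymbol (α β : GaussianInt) : ℂ :=
  ((UniqueFactorizationMonoid.factors β).map fun π => quarticResidueSymbol α π).prod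

/-- The quartic Jacobi symbol `(t/β)₄` of a rational number `t` whose denominator is prime to `β`,
extended multiplicatively: `(u/v / β)₄ = (u/β)₄ (v/β)₄⁻¹`, here with `u/v` the reduced form
of `t`. -/
noncomputable def quarticJacobiSymbolRat (t : ℚ) (β : GaussianInt) : ℂ :=
  quarticJacobiSymbol (t.num : GaussianInt) β / quarticJacobiSymbol (t.den : GaussianInt) β

namespace QuarticSymbol

open Complex (I)

/-! Put π = d + ci, ϖ = c − di (so π = iϖ), β = b + ai and Q = ββ̄ = a² + b². Reduction modulo ϖ
maps ℤ[i] onto ℤ/p and sends i to w = c/d. From x² ≡ −2Qy² and (1 + w)² = 2w one gets −Q =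
w·(x/((1+w)y))². Hence (−Q)^((p−1)/8) is a power of w whose exponent is read off from the quartic
symbols of x, y and 1 + i modulo ϖ (`exists_zpow_eq`). On the other side ac + bd ≡ aϖ = −iaπ (mod
β), so the symbol of (ac + bd)/x modulo β is made of (π/β), (x/β) and the explicit values of (i/β)
and (a/β) (`jacobi_im`). What remains is to relate (π/β)/(x/β) to (x/ϖ)/(y/ϖ); this is
`symbol_identity`.

The bridge is γ = sx + s̄π with s = 1 + vi, which satisfies γπ̄ − xγ̄ = 2s̄Qy². Read modulo β, this
yields (π/β) = (x/β)(γ/Q). Writing γ = (1+i)γ₁, reciprocity turns (γ/Q) into (Q/γ₁) up to a power of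
i. The norm N(γ₁) = xh + (1+v²)Qy² then expresses (Q/γ₁) by the symbols of −1, x, h, 1+v² and y
modulo γ₁. In `auxiliary_identity` the symbols of h and 1+v² both produce the unknown (π/s), which
cancels, and the others reduce to symbols modulo ϖ. The free parameter v makes h prime to Qyp, so
that no symbol vanishes.

Reciprocity is needed only between a rational and a Gaussian integer (`reciprocity`). It comes from
raising a quartic Gauss sum to the q-th power in characteristic q, its fourth power being J²p, where
the Jacobi sum J is ±π for π of even imaginary part (`jacobiSum_quarticChar`). The theorem then
becomes a comparison of exponents modulo 4. -/

/-- The imaginary unit of the ring of Gaussian integers. -/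
abbrev gaussI : GaussianInt := ⟨0, 1⟩

/-! ### Fourth roots of unity, norms and odd primes in ℤ[i] -/

theorem gaussI_mul_self : gaussI * gaussI = -1 := by ext <;> simp [gaussI]

theorem gaussI_sq : gaussI ^ 2 = -1 := by rw [sq, gaussI_mul_self]

theorem gaussI_pow_four : gaussI ^ 4 = 1 := by
  rw [show 4 = 2 * 2 from rfl, pow_mul, gaussI_sq]; norm_num

theorem norm_eq (α : GaussianInt) : α.norm = α.re ^ 2 + α.im ^ 2 := by
  rw [Zsqrtd.norm_def]; ring

theorem eq_intCast_add (α : GaussianInt) :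
    α = (α.re : GaussianInt) + (α.im : GaussianInt) * gaussI := by
  ext <;> simp [gaussI]

theorem toComplex_gaussI : GaussianInt.toComplex gaussI = I := by
  simp [gaussI, GaussianInt.toComplex_def]

theorem I_pow_eq_iff (k l : ℕ) : I ^ k = I ^ l ↔ gaussI ^ k = gaussI ^ l := by
  rw [← toComplex_gaussI, ← map_pow, ← map_pow, GaussianInt.toComplex_inj]

theorem I_pow_four_mul (n : ℕ) : I ^ (4 * n) = 1 := by rw [pow_mul, Complex.I_pow_four, one_pow]

theorem odd_norm_ne_zero {β : GaussianInt} (h : Odd β.norm) : β ≠ 0 := by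
  rintro rfl; simp at h

theorem odd_norm_mul_iff {α β : GaussianInt} :
    Odd (α * β).norm ↔ Odd α.norm ∧ Odd β.norm := by
  rw [Zsqrtd.norm_mul, Int.odd_mul]

theorem norm_emod_four {β : GaussianInt} (h : Odd β.norm) : β.norm % 4 = 1 := by
  have key : ∀ u : ℤ, ∃ w, u ^ 2 = 4 * w ∨ u ^ 2 = 4 * w + 1 := fun u => by
    rcases Int.even_or_odd' u with ⟨v, rfl | rfl⟩
    · exact ⟨v ^ 2, Or.inl (by ring)⟩
    · exact ⟨v ^ 2 + v, Or.inr (by ring)⟩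
  rw [norm_eq, Int.odd_iff] at *
  obtain ⟨u, hu⟩ := key β.re
  obtain ⟨v, hv⟩ := key β.im
  omega

theorem natAbs_norm_sub_one {β : GaussianInt} (h : Odd β.norm) :
    4 * ((β.norm.natAbs - 1) / 4) = β.norm.natAbs - 1 ∧ 0 < β.norm.natAbs := by
  have h1 := norm_emod_four h
  have h2 := GaussianInt.norm_nonneg β
  omega

theorem isUnit_of_dvd_two {π : GaussianInt} (ho : Odd π.norm) (h : π.norm ∣ 4) : IsUnit π := by
  rw [← Zsqrtd.norm_eq_one_iff]
  have h2 := GaussianInt.norm_nonneg π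
  have h3 : π.norm ≤ 4 := Int.le_of_dvd (by norm_num) h
  rw [Int.odd_iff] at ho
  generalize π.norm = n at *
  interval_cases n <;> first | rfl | omega

/-- Distinct fourth roots of unity are incongruent modulo an odd Gaussian prime. -/
theorem gaussI_pow_inj {π : GaussianInt} (hπ : Prime π) (ho : Odd π.norm) {k l : ℕ}
    (h : π ∣ gaussI ^ k - gaussI ^ l) : I ^ k = I ^ l := by
  rw [I_pow_eq_iff]
  have key : ∀ k : ℕ, gaussI ^ k = gaussI ^ (k % 4) := fun k => by
    conv_lhs => rw [← Nat.div_add_mod k 4, pow_add, pow_mul, gaussI_pow_four, one_pow, one_mul]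
  rw [key k, key l] at h ⊢
  by_contra hne
  apply hπ.not_isUnit
  apply isUnit_of_dvd_two ho
  have h1 : π.norm ∣ (gaussI ^ (k % 4) - gaussI ^ (l % 4)).norm := by
    obtain ⟨w, hw⟩ := h
    exact ⟨w.norm, by rw [hw, Zsqrtd.norm_mul]⟩
  refine h1.trans ?_
  have hk : k % 4 < 4 := Nat.mod_lt _ (by norm_num)
  have hl : l % 4 < 4 := Nat.mod_lt _ (by norm_num)
  generalize k % 4 = k at *
  generalize l % 4 = l at *
  interval_cases k <;> interval_cases l <;> first | exact absurd rfl hne | decide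

theorem prime_of_norm_prime {π : GaussianInt} {p : ℕ} (hp : p.Prime)
    (h : π.norm = p) : Prime π := by
  rw [← irreducible_iff_prime]
  constructor
  · rw [← Zsqrtd.norm_eq_one_iff, h, Int.natAbs_natCast]; exact hp.one_lt.ne'
  · intro a b hab
    rw [hab, Zsqrtd.norm_mul] at h
    have h2 : a.norm.natAbs * b.norm.natAbs = p := by
      rw [← Int.natAbs_mul, h, Int.natAbs_natCast]
    have h3 := hp
    rw [← h2, Nat.prime_mul_iff] at h3
    rw [← Zsqrtd.norm_eq_one_iff, ← Zsqrtd.norm_eq_one_iff]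
    tauto

/-- An odd Gaussian prime is split or inert. -/
theorem prime_cases {π : GaussianInt} (hπ : Prime π) (ho : Odd π.norm) :
    (∃ p : ℕ, p.Prime ∧ π.norm = p ∧ p % 4 = 1) ∨
      ∃ q : ℕ, q.Prime ∧ q % 4 = 3 ∧ Associated π (q : GaussianInt) := by
  have h0 : π.norm.natAbs ≠ 0 := by
    rw [Int.natAbs_ne_zero]; intro h; rw [h] at ho; simp at ho
  have h1 : π ∣ ((π.norm.natAbs : ℕ) : GaussianInt) := by
    rw [GaussianInt.natCast_natAbs_norm, Zsqrtd.norm_eq_mul_conj]; exact dvd_mul_right _ _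
  have h2 : ∃ q : ℕ, q.Prime ∧ π ∣ (q : GaussianInt) := by
    rw [← Nat.prod_primeFactorsList h0, Nat.cast_list_prod, hπ.dvd_prod_iff] at h1
    obtain ⟨x, hx, hd⟩ := h1
    obtain ⟨q, hq, rfl⟩ := List.mem_map.1 hx
    exact ⟨q, Nat.prime_of_mem_primeFactorsList hq, hd⟩
  obtain ⟨q, hq, w, hw⟩ := h2
  have := Fact.mk hq
  have h3 : q * q = π.norm.natAbs * w.norm.natAbs := by
    rw [← Int.natAbs_mul, ← Zsqrtd.norm_mul, ← hw, Zsqrtd.norm_natCast, Int.natAbs_mul]; simp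
  have h4 : π.norm.natAbs ∣ q ^ 2 := ⟨_, by rw [sq, h3]⟩
  rw [Nat.dvd_prime_pow hq] at h4
  obtain ⟨k, hk, hk'⟩ := h4
  have h5 := norm_emod_four ho
  have h6 := GaussianInt.norm_nonneg π
  interval_cases k
  · exact absurd (Zsqrtd.norm_eq_one_iff.1 (by simpa using hk')) hπ.not_isUnit
  · left; refine ⟨q, hq, ?_, ?_⟩ <;> rw [pow_one] at hk' <;> omega
  · right
    have h7 : w.norm.natAbs = 1 := by
      rw [hk', sq] at h3
      have := Nat.mul_pos hq.pos hq.pos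
      exact (Nat.eq_of_mul_eq_mul_left this (by rw [mul_one]; exact h3)).symm
    have h8 : Associated π (q : GaussianInt) :=
      ⟨(Zsqrtd.norm_eq_one_iff.1 h7).unit, by rw [hw]; rfl⟩
    exact ⟨q, hq, (GaussianInt.prime_iff_mod_four_eq_three_of_nat_prime q).1
      ((h8.prime_iff).1 hπ), h8⟩

/-- The ideal (π) is maximal, so a homomorphism to a nontrivial ring that kills π has kernel exactly
(π). Divisibility by π can thus be tested in `ZMod p`, or in an algebraic closure when π is inert.
-/
theorem hom_eq_zero_iff {R : Type*} [CommRing R] [Nontrivial R] (f : GaussianInt →+* R)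
    {π : GaussianInt} (hπ : Prime π) (hf : f π = 0) (α : GaussianInt) : f α = 0 ↔ π ∣ α := by
  constructor
  · intro h
    by_contra hd
    obtain ⟨a, b, hab⟩ := (irreducible_iff_prime.2 hπ).coprime_iff_not_dvd.2 hd
    have := congrArg f hab
    simp [hf, h] at this
  · rintro ⟨w, rfl⟩; rw [map_mul, hf, zero_mul]

/-- The ring homomorphism from the Gaussian integers determined by a square root of `-1`. -/
def homOfSq {R : Type*} [CommRing R] (r : R) (hr : r * r = -1) : GaussianInt →+* R :=
  Zsqrtd.lift ⟨r, by rw [hr]; norm_num⟩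

theorem homOfSq_apply {R : Type*} [CommRing R] (r : R) (hr : r * r = -1) (α : GaussianInt) :
    homOfSq r hr α = α.re + α.im * r := rfl

/-- The element i is sent to −re/im. The imaginary part is invertible modulo p, since otherwise p
would divide both coordinates and p² would divide the norm p. -/
theorem exists_hom_zmod {π : GaussianInt} {p : ℕ} [Fact p.Prime] (h : π.norm = p) :
    ∃ f : GaussianInt →+* ZMod p, f π = 0 := by
  rw [norm_eq] at h
  have hz : (π.re : ZMod p) ^ 2 + (π.im : ZMod p) ^ 2 = 0 := by
    have := congrArg (Int.cast : ℤ → ZMod p) h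
    push_cast at this
    rw [this, ZMod.natCast_self]
  have him : (π.im : ZMod p) ≠ 0 := by
    intro h0
    rw [h0] at hz
    have h1 : (π.re : ZMod p) = 0 := by simpa using hz
    rw [ZMod.intCast_zmod_eq_zero_iff_dvd] at h0 h1
    obtain ⟨u, hu⟩ := h0
    obtain ⟨v, hv⟩ := h1
    have hp : (p : ℤ) ≠ 0 := by exact_mod_cast (Fact.out : p.Prime).ne_zero
    have h2 : (p : ℤ) * (v ^ 2 + u ^ 2) = 1 := by
      apply mul_left_cancel₀ hp
      rw [hu, hv] at h
      linear_combination h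
    have h3 : IsUnit (p : ℤ) := IsUnit.of_mul_eq_one _ h2
    rw [Int.isUnit_iff_natAbs_eq, Int.natAbs_natCast] at h3
    exact (Fact.out : p.Prime).one_lt.ne' h3
  refine ⟨homOfSq (-(π.re : ZMod p) / π.im) ?_, ?_⟩
  · field_simp; linear_combination hz
  · rw [homOfSq_apply]; field_simp; ring

/-- Fermat's little theorem for odd Gaussian primes. -/
theorem dvd_pow_sub_one {π α : GaussianInt} (hπ : Prime π) (ho : Odd π.norm) (h : ¬ π ∣ α) :
    π ∣ α ^ (π.norm.natAbs - 1) - 1 := by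
  rcases prime_cases hπ ho with ⟨p, hp, hN, -⟩ | ⟨q, hq, hq3, ha⟩
  · have := Fact.mk hp
    obtain ⟨f, hf⟩ := exists_hom_zmod hN
    rw [← hom_eq_zero_iff f hπ hf] at h ⊢
    rw [hN, Int.natAbs_natCast, map_sub, map_pow, map_one, ZMod.pow_card_sub_one_eq_one h, sub_self]
  · have := Fact.mk hq
    obtain ⟨r, hr⟩ := IsAlgClosed.exists_pow_nat_eq (-1 : AlgebraicClosure (ZMod q)) two_pos
    have : CharP (AlgebraicClosure (ZMod q)) q := charP_of_injective_algebraMap'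
      (ZMod q) q
    set f := homOfSq r (by rw [← sq, hr])
    have hf : f π = 0 := by
      obtain ⟨u, hu⟩ := ha.symm
      rw [← hu, map_mul, map_natCast, CharP.cast_eq_zero, zero_mul]
    have hN : π.norm.natAbs = q * q := by
      rw [Zsqrtd.norm_eq_of_associated (by norm_num) ha, Zsqrtd.norm_natCast]
      norm_cast
    have hint : ∀ z : ℤ, (z : AlgebraicClosure (ZMod q)) ^ q = z := fun z => by
      have := congrArg (algebraMap (ZMod q) (AlgebraicClosure (ZMod q))) (ZMod.pow_card (z : ZMod q))
      rwa [map_pow, map_intCast] at this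
    -- The norm of an inert prime is q², so Frobenius is applied twice; this fixes r because q² ≡ 1
    -- (mod 8) and r⁴ = 1.
    have hrq : (r ^ q) ^ q = r := by
      rw [← pow_mul, show q * q = 2 * (4 * ((q * q) / 8)) + 1 by
        have h8 : q * q % 8 = 1 := by
          rw [Nat.mul_mod]
          have : q % 8 = 3 ∨ q % 8 = 7 := by omega
          rcases this with h | h <;> rw [h]
        omega, pow_succ, pow_mul, hr, pow_mul]
      norm_num
    have hfr : f α ^ (q * q) = f α := by
      rw [homOfSq_apply, pow_mul, add_pow_char, mul_pow, add_pow_char, mul_pow, hrq]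
      simp only [hint]
    rw [← hom_eq_zero_iff f hπ hf] at h ⊢
    rw [hN, map_sub, map_pow, map_one, sub_eq_zero]
    apply mul_right_cancel₀ h
    rw [← pow_succ, one_mul, Nat.sub_add_cancel (Nat.mul_pos hq.pos hq.pos), hfr]

theorem exists_pow_sub_gaussI_pow {π α : GaussianInt} (hπ : Prime π) (ho : Odd π.norm)
    (h : ¬ π ∣ α) : ∃ k : ℕ, π ∣ α ^ ((π.norm.natAbs - 1) / 4) - gaussI ^ k := by
  have h1 := dvd_pow_sub_one hπ ho h
  rw [← (natAbs_norm_sub_one ho).1, mul_comm, pow_mul] at h1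
  generalize α ^ ((π.norm.natAbs - 1) / 4) = w at *
  rw [show w ^ 4 - 1 = (w - gaussI ^ 0) * ((w - gaussI ^ 1) * ((w - gaussI ^ 2) *
    (w - gaussI ^ 3))) by
      rw [pow_succ gaussI 2, gaussI_sq]
      linear_combination (w ^ 2 - 1) * gaussI_sq] at h1
  rcases hπ.dvd_or_dvd h1 with h1 | h1
  · exact ⟨_, h1⟩
  rcases hπ.dvd_or_dvd h1 with h1 | h1
  · exact ⟨_, h1⟩
  rcases hπ.dvd_or_dvd h1 with h1 | h1
  · exact ⟨_, h1⟩
  · exact ⟨_, h1⟩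

/-! ### The quartic residue symbol at a prime -/

theorem residueSymbol_of_dvd {π α : GaussianInt} (h : π ∣ α) : quarticResidueSymbol α π = 0 := by
  rw [quarticResidueSymbol, if_pos h]

theorem residueSymbol_eq {π α : GaussianInt} (hπ : Prime π) (ho : Odd π.norm)
    {k : ℕ} (hk : π ∣ α ^ ((π.norm.natAbs - 1) / 4) - gaussI ^ k) (h : ¬ π ∣ α) :
    quarticResidueSymbol α π = I ^ k := by
  have key : ∀ l : ℕ, π ∣ α ^ ((π.norm.natAbs - 1) / 4) - gaussI ^ l → I ^ l = I ^ k :=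
    fun l hl => gaussI_pow_inj hπ ho (by simpa using dvd_sub hk hl)
  have hI3 : I ^ 3 = -I := Complex.I_pow_three
  rw [quarticResidueSymbol, if_neg h]
  split_ifs with h0 h1 h2 h3
  · rw [← key 0 (by simpa using h0), pow_zero]
  · rw [← key 1 (by simpa using h1), pow_one]
  · rw [← key 2 (by simpa [gaussI_sq] using h2), Complex.I_sq]
  · rw [← key 3 (by rw [pow_succ, gaussI_sq]; simpa using h3), hI3]
  · exfalso
    have : gaussI ^ k = gaussI ^ (k % 4) := by
      conv_lhs => rw [← Nat.div_add_mod k 4, pow_add, pow_mul, gaussI_pow_four, one_pow, one_mul]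
    rw [this] at hk
    have hlt : k % 4 < 4 := Nat.mod_lt _ (by norm_num)
    generalize k % 4 = l at *
    interval_cases l
    · exact h0 (by simpa using hk)
    · exact h1 (by simpa using hk)
    · exact h2 (by simpa [gaussI_sq] using hk)
    · exact h3 (by rw [pow_succ, gaussI_sq] at hk; simpa using hk)

theorem exists_residueSymbol_eq {π α : GaussianInt} (hπ : Prime π) (ho : Odd π.norm)
    (h : ¬ π ∣ α) : ∃ k : ℕ, quarticResidueSymbol α π = I ^ k ∧
      π ∣ α ^ ((π.norm.natAbs - 1) / 4) - gaussI ^ k := by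
  obtain ⟨k, hk⟩ := exists_pow_sub_gaussI_pow hπ ho h
  exact ⟨k, residueSymbol_eq hπ ho hk h, hk⟩

theorem residueSymbol_mul {π : GaussianInt} (hπ : Prime π) (ho : Odd π.norm) (α α' : GaussianInt) :
    quarticResidueSymbol (α * α') π = quarticResidueSymbol α π * quarticResidueSymbol α' π := by
  by_cases h : π ∣ α
  · rw [residueSymbol_of_dvd h, residueSymbol_of_dvd (h.mul_right _), zero_mul]
  by_cases h' : π ∣ α'
  · rw [residueSymbol_of_dvd h', residueSymbol_of_dvd (h'.mul_left _), mul_zero]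
  obtain ⟨k, hk, hk'⟩ := exists_residueSymbol_eq hπ ho h
  obtain ⟨l, hl, hl'⟩ := exists_residueSymbol_eq hπ ho h'
  rw [hk, hl, ← pow_add]
  refine residueSymbol_eq hπ ho ?_ (hπ.not_dvd_mul h h')
  rw [mul_pow, pow_add]
  generalize α ^ ((π.norm.natAbs - 1) / 4) = w at *
  generalize α' ^ ((π.norm.natAbs - 1) / 4) = w' at *
  have := dvd_add (hk'.mul_right w') (hl'.mul_left (gaussI ^ k))
  convert this using 1; ring

theorem residueSymbol_congr {π α α' : GaussianInt} (hπ : Prime π) (ho : Odd π.norm)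
    (h : π ∣ α - α') : quarticResidueSymbol α π = quarticResidueSymbol α' π := by
  by_cases h' : π ∣ α'
  · rw [residueSymbol_of_dvd h', residueSymbol_of_dvd]
    simpa using dvd_add h h'
  obtain ⟨l, hl, hl'⟩ := exists_residueSymbol_eq hπ ho h'
  rw [hl]
  refine residueSymbol_eq hπ ho ?_ fun h1 => h' (by simpa using dvd_sub h1 h)
  have := dvd_add (h.trans (sub_dvd_pow_sub_pow α α' ((π.norm.natAbs - 1) / 4))) hl'
  simpa using this

theorem residueSymbol_associated {π π' : GaussianInt} (h : Associated π π') (α : GaussianInt) :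
    quarticResidueSymbol α π = quarticResidueSymbol α π' := by
  have hd : ∀ x, π ∣ x ↔ π' ∣ x := fun x => h.dvd_iff_dvd_left
  rw [quarticResidueSymbol, quarticResidueSymbol, Zsqrtd.norm_eq_of_associated (by norm_num) h]
  congr! 1
  · exact hd _
  congr! 1
  · exact hd _
  congr! 1
  · exact hd _
  congr! 1
  · exact hd _
  congr! 1
  exact hd _

theorem star_gaussI : star gaussI = gaussI ^ 3 := by decide

theorem star_dvd_star {α β : GaussianInt} (h : α ∣ β) : star α ∣ star β :=
  map_dvd (starRingEnd GaussianInt) h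

theorem prime_star {π : GaussianInt} (hπ : Prime π) : Prime (star π) :=
  (MulEquiv.prime_iff (starRingAut (R := GaussianInt)).toMulEquiv).2 hπ

theorem residueSymbol_star {π : GaussianInt} (hπ : Prime π) (ho : Odd π.norm) (α : GaussianInt) :
    quarticResidueSymbol (star α) (star π) = star (quarticResidueSymbol α π) := by
  by_cases h : π ∣ α
  · rw [residueSymbol_of_dvd h, residueSymbol_of_dvd (star_dvd_star h), star_zero]
  obtain ⟨k, hk, hk'⟩ := exists_residueSymbol_eq hπ ho h
  have ho' : Odd (star π).norm := by rwa [Zsqrtd.norm_conj]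
  have h' : ¬ star π ∣ star α := fun h1 => h (by simpa using star_dvd_star h1)
  rw [hk, residueSymbol_eq (prime_star hπ) ho' (k := 3 * k) _ h', star_pow, pow_mul]
  · simp
  · have := star_dvd_star hk'
    rw [star_sub, star_pow, star_pow, star_gaussI, ← pow_mul] at this
    rwa [Zsqrtd.norm_conj]

/-! ### The quartic Jacobi symbol: multiplicativity, periodicity, conjugation -/

theorem prod_map_eq_of_rel {s t : Multiset GaussianInt} (h : Multiset.Rel Associated s t)
    (α : GaussianInt) :
    (s.map fun π => quarticResidueSymbol α π).prod =
      (t.map fun π => quarticResidueSymbol α π).prod := by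
  congr 1
  rw [← Multiset.rel_eq, Multiset.rel_map]
  exact h.mono fun a _ b _ hab => residueSymbol_associated hab α

theorem jacobi_one (α : GaussianInt) : quarticJacobiSymbol α 1 = 1 := by
  simp [quarticJacobiSymbol]

theorem jacobi_prime {π : GaussianInt} (hπ : Prime π) (α : GaussianInt) :
    quarticJacobiSymbol α π = quarticResidueSymbol α π := by
  obtain ⟨π', h, h'⟩ := UniqueFactorizationMonoid.factors_eq_singleton_of_irreducible hπ.irreducible
  rw [quarticJacobiSymbol, h', Multiset.map_singleton, Multiset.prod_singleton,
    residueSymbol_associated h]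

theorem jacobi_mul_right {β β' : GaussianInt} (h : β ≠ 0) (h' : β' ≠ 0) (α : GaussianInt) :
    quarticJacobiSymbol α (β * β') = quarticJacobiSymbol α β * quarticJacobiSymbol α β' := by
  rw [quarticJacobiSymbol, prod_map_eq_of_rel (UniqueFactorizationMonoid.factors_mul h h'),
    Multiset.map_add, Multiset.prod_add]
  rfl

theorem jacobi_isUnit {β : GaussianInt} (h : IsUnit β) (α : GaussianInt) :
    quarticJacobiSymbol α β = 1 := by
  rw [quarticJacobiSymbol, UniqueFactorizationMonoid.factors_of_isUnit h]; simp

theorem jacobi_isUnit_mul {u : GaussianInt} (hu : IsUnit u) {β : GaussianInt} (h : β ≠ 0)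
    (α : GaussianInt) : quarticJacobiSymbol α (u * β) = quarticJacobiSymbol α β := by
  rw [jacobi_mul_right hu.ne_zero h, jacobi_isUnit hu, one_mul]

theorem odd_induction {P : ∀ β : GaussianInt, Odd β.norm → Prop}
    (unit : ∀ u h, IsUnit u → P u h)
    (mul : ∀ π β (_ : Prime π) (_ : Odd π.norm) (ho : Odd β.norm) (h : Odd (π * β).norm),
      P β ho → P (π * β) h) (β : GaussianInt) (h : Odd β.norm) : P β h := by
  induction β using UniqueFactorizationMonoid.induction_on_prime with
  | h₁ => exact absurd rfl (odd_norm_ne_zero h)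
  | h₂ u h' => exact unit u h h'
  | h₃ β π hβ hπ ih =>
    obtain ⟨h1, h2⟩ := odd_norm_mul_iff.1 h
    exact mul π β hπ h1 h2 h (ih h2)

theorem jacobi_mul_left {β : GaussianInt} (h : Odd β.norm) (α α' : GaussianInt) :
    quarticJacobiSymbol (α * α') β = quarticJacobiSymbol α β * quarticJacobiSymbol α' β := by
  induction β, h using odd_induction with
  | unit u h hu => simp [jacobi_isUnit hu]
  | mul π β hπ ho ho' h ih =>
    simp only [jacobi_mul_right hπ.ne_zero (odd_norm_ne_zero ho'), jacobi_prime hπ,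
      residueSymbol_mul hπ ho, ih]
    ring

theorem jacobi_congr {β : GaussianInt} (h : Odd β.norm) {α α' : GaussianInt} (hd : β ∣ α - α') :
    quarticJacobiSymbol α β = quarticJacobiSymbol α' β := by
  induction β, h using odd_induction with
  | unit u h hu => simp [jacobi_isUnit hu]
  | mul π β hπ ho ho' h ih =>
    rw [jacobi_mul_right hπ.ne_zero (odd_norm_ne_zero ho'),
      jacobi_mul_right hπ.ne_zero (odd_norm_ne_zero ho'), jacobi_prime hπ, jacobi_prime hπ,
      residueSymbol_congr hπ ho (dvd_of_mul_right_dvd hd), ih (dvd_of_mul_left_dvd hd)]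

theorem exists_jacobi_eq {α β : GaussianInt} (h : Odd β.norm) (hc : IsCoprime α β) :
    ∃ k : ℕ, quarticJacobiSymbol α β = I ^ k := by
  induction β, h using odd_induction with
  | unit u h hu => exact ⟨0, by simp [jacobi_isUnit hu]⟩
  | mul π β hπ ho ho' h ih =>
    obtain ⟨k, hk⟩ := ih hc.of_mul_right_right
    have h1 : ¬ π ∣ α := fun hd => hπ.not_isUnit (hc.of_mul_right_left.isUnit_of_dvd' hd dvd_rfl)
    obtain ⟨l, hl, -⟩ := exists_residueSymbol_eq hπ ho h1
    exact ⟨l + k, by rw [jacobi_mul_right hπ.ne_zero (odd_norm_ne_zero ho'), jacobi_prime hπ, hk,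
      hl, pow_add]⟩

theorem jacobi_pow_four {α β : GaussianInt} (h : Odd β.norm) (hc : IsCoprime α β) :
    quarticJacobiSymbol α β ^ 4 = 1 := by
  obtain ⟨k, hk⟩ := exists_jacobi_eq h hc
  rw [hk, ← pow_mul, mul_comm, I_pow_four_mul]

theorem jacobi_ne_zero {α β : GaussianInt} (h : Odd β.norm) (hc : IsCoprime α β) :
    quarticJacobiSymbol α β ≠ 0 := fun h0 => by
  have := jacobi_pow_four h hc
  rw [h0] at this; norm_num at this

theorem jacobi_mul_star {α β : GaussianInt} (h : Odd β.norm) (hc : IsCoprime α β) :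
    quarticJacobiSymbol α β * star (quarticJacobiSymbol α β) = 1 := by
  obtain ⟨k, hk⟩ := exists_jacobi_eq h hc
  rw [hk, star_pow, ← mul_pow]
  simp

theorem jacobi_star {β : GaussianInt} (h : Odd β.norm) (α : GaussianInt) :
    quarticJacobiSymbol (star α) (star β) = star (quarticJacobiSymbol α β) := by
  induction β, h using odd_induction with
  | unit u h hu =>
    rw [jacobi_isUnit hu, star_one]
    exact jacobi_isUnit (hu.map (starRingEnd GaussianInt)) _
  | mul π β hπ ho ho' h ih =>
    have h0 := (prime_star hπ).ne_zero
    have h1 : star β ≠ 0 := by simpa using odd_norm_ne_zero ho'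
    rw [star_mul', jacobi_mul_right h0 h1,
      jacobi_mul_right hπ.ne_zero (odd_norm_ne_zero ho'), jacobi_prime hπ,
      jacobi_prime (prime_star hπ), residueSymbol_star hπ ho, ih, star_mul']

/-! ### Symbols of units, and symbols modulo rational integers -/

theorem I_zpow_four_mul (n : ℤ) : I ^ (4 * n) = 1 := by
  rw [zpow_mul, show (4 : ℤ) = (4 : ℕ) from rfl, zpow_natCast, Complex.I_pow_four, one_zpow]

theorem I_zpow_congr {m n : ℤ} (h : m ≡ n [ZMOD 4]) : I ^ m = I ^ n := by
  obtain ⟨k, hk⟩ := h.dvd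
  rw [show n = m + 4 * k by omega, zpow_add₀ Complex.I_ne_zero, I_zpow_four_mul, mul_one]

theorem jacobi_gaussI {β : GaussianInt} (h : Odd β.norm) {e : ℤ} (he : β.norm = 4 * e + 1) :
    quarticJacobiSymbol gaussI β = I ^ e := by
  induction β, h using odd_induction generalizing e with
  | unit u h hu =>
    rw [jacobi_isUnit hu]
    rw [← Zsqrtd.norm_eq_one_iff' (by norm_num)] at hu
    rw [show e = 0 by omega, zpow_zero]
  | mul π β hπ ho ho' h ih =>
    have h1 := norm_emod_four ho
    have h2 := norm_emod_four ho'
    obtain ⟨u, hu⟩ : ∃ u, β.norm = 4 * u + 1 := ⟨β.norm / 4, by omega⟩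
    have h0 := GaussianInt.norm_nonneg π
    obtain ⟨v, hv⟩ : ∃ v : ℕ, π.norm = 4 * v + 1 := ⟨(π.norm / 4).toNat, by omega⟩
    have h3 : quarticResidueSymbol gaussI π = I ^ v := by
      apply residueSymbol_eq hπ ho
      · rw [show (π.norm.natAbs - 1) / 4 = v by omega, sub_self]; exact dvd_zero _
      · intro hd
        exact hπ.not_isUnit (isUnit_of_dvd_unit hd (IsUnit.of_mul_eq_one (-gaussI)
          (by rw [mul_neg, gaussI_mul_self, neg_neg])))
    rw [jacobi_mul_right hπ.ne_zero (odd_norm_ne_zero ho'), jacobi_prime hπ, h3, ih hu,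
      ← zpow_natCast, ← zpow_add₀ Complex.I_ne_zero]
    rw [Zsqrtd.norm_mul, hu, hv] at he
    apply I_zpow_congr
    rw [Int.modEq_iff_dvd]
    exact ⟨v * u, by linarith⟩

theorem jacobi_neg_one {β : GaussianInt} (h : Odd β.norm) {e : ℤ} (he : β.norm = 4 * e + 1) :
    quarticJacobiSymbol (-1) β = (-1) ^ e := by
  rw [← gaussI_mul_self, jacobi_mul_left h, jacobi_gaussI h he, ← mul_zpow, Complex.I_mul_I]

theorem int_odd_induction {P : ∀ n : ℤ, Odd n → Prop} (one : P 1 odd_one)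
    (neg : ∀ n (h : Odd n), P n h → P (-n) h.neg)
    (mul : ∀ (q : ℕ) (n : ℤ) (_ : q.Prime) (hq : Odd (q : ℤ)) (hn : Odd n),
      P n hn → P (q * n) (hq.mul hn)) (n : ℤ) (h : Odd n) : P n h := by
  have key : ∀ (m : ℕ) (h : Odd (m : ℤ)), P m h := by
    intro m
    induction m using induction_on_primes with
    | zero => intro h; simp at h
    | one => exact fun _ => one
    | prime_mul q m hq ih =>
      intro h
      obtain ⟨h2, h3⟩ := Int.odd_mul.1 (by simpa using h)
      convert mul q m hq h2 h3 (ih h3) using 1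
      push_cast; rfl
  obtain ⟨m, rfl | rfl⟩ := n.eq_nat_or_neg
  · exact key m h
  · exact neg _ (by simpa using h) (key m (by simpa using h))

theorem odd_norm_intCast {n : ℤ} (h : Odd n) : Odd (n : GaussianInt).norm := by
  rw [Zsqrtd.norm_intCast]; exact h.mul h

theorem jacobi_neg_right {n : GaussianInt} (h : n ≠ 0) (α : GaussianInt) :
    quarticJacobiSymbol α (-n) = quarticJacobiSymbol α n := by
  rw [← neg_one_mul, jacobi_isUnit_mul isUnit_one.neg h]

theorem star_intCast (n : ℤ) : star (n : GaussianInt) = n := by ext <;> simp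

theorem isCoprime_one_add_gaussI {β : GaussianInt} (h : Odd β.norm) : IsCoprime (1 + gaussI) β := by
  obtain ⟨k, hk⟩ := h
  have h2 := Zsqrtd.norm_eq_mul_conj β
  rw [hk] at h2
  push_cast at h2
  exact ⟨-(1 - gaussI) * k, star β, by linear_combination (k : GaussianInt) * gaussI_sq - h2⟩

theorem isCoprime_two {β : GaussianInt} (h : Odd β.norm) : IsCoprime 2 β := by
  have h1 := isCoprime_one_add_gaussI h
  have h2 := h1.mul_left h1
  rw [show (1 + gaussI) * (1 + gaussI) = 2 * gaussI by linear_combination gaussI_sq] at h2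
  exact h2.of_mul_left_left

/-- A split odd rational prime is the norm of a Gaussian prime. -/
theorem exists_norm_eq {q : ℕ} (hq : q.Prime) (h : q % 4 = 1) :
    ∃ κ : GaussianInt, Prime κ ∧ κ.norm = q := by
  have := Fact.mk hq
  obtain ⟨a, b, hab⟩ := Nat.Prime.sq_add_sq (p := q) (by omega)
  have : (⟨a, b⟩ : GaussianInt).norm = q := by
    rw [norm_eq]; simp only; exact_mod_cast hab
  exact ⟨_, prime_of_norm_prime hq this, this⟩

theorem jacobi_split {q : ℕ} {κ : GaussianInt} (hκ : Prime κ) (h : κ.norm = q) (α : GaussianInt) :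
    quarticJacobiSymbol α q = quarticJacobiSymbol α κ * quarticJacobiSymbol α (star κ) := by
  rw [← jacobi_mul_right hκ.ne_zero (prime_star hκ).ne_zero, ← Zsqrtd.norm_eq_mul_conj, h,
    Int.cast_natCast]

theorem isCoprime_of_norm_dvd {α κ β : GaussianInt} (h : IsCoprime α β) (hd : κ ∣ β) :
    IsCoprime α κ := h.of_isCoprime_of_dvd_right hd

/-- Rational integers are quartic residues modulo coprime odd rational integers. -/
theorem jacobi_intCast {n : ℤ} (hn : Odd n) {r : ℤ} (hc : IsCoprime (r : GaussianInt) n) :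
    quarticJacobiSymbol r n = 1 := by
  induction n, hn using int_odd_induction with
  | one => simp [jacobi_one]
  | neg n hn ih =>
    have h0 := odd_norm_ne_zero (odd_norm_intCast hn)
    push_cast at hc ⊢
    rw [jacobi_neg_right h0]; exact ih (by rwa [IsCoprime.neg_right_iff] at hc)
  | mul q n hq hqo hn ih =>
    have h0 := odd_norm_ne_zero (odd_norm_intCast hn)
    have hq0 := odd_norm_ne_zero (odd_norm_intCast hqo)
    push_cast at hc hq0 ⊢
    rw [jacobi_mul_right hq0 h0, ih hc.of_mul_right_right, mul_one]
    replace hc := hc.of_mul_right_left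
    have : q % 4 = 1 ∨ q % 4 = 3 := by
      rw [Int.odd_iff] at hqo; omega
    rcases this with h4 | h4
    · obtain ⟨κ, hκ, hN⟩ := exists_norm_eq hq h4
      have hκo : Odd κ.norm := by rwa [hN]
      have hd : κ ∣ (q : GaussianInt) := by
        rw [← Int.cast_natCast, ← hN, Zsqrtd.norm_eq_mul_conj]; exact dvd_mul_right _ _
      rw [jacobi_split hκ hN]
      -- As r is its own conjugate, its symbols modulo κ and κ̄ are conjugate roots of unity, with
      -- product 1.
      nth_rw 2 [← star_intCast]
      rw [jacobi_star hκo, jacobi_mul_star hκo (isCoprime_of_norm_dvd hc hd)]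
    · have := Fact.mk hq
      have hqp := GaussianInt.prime_of_nat_prime_of_mod_four_eq_three q h4
      have hqo' := odd_norm_intCast hqo
      rw [Int.cast_natCast] at hqo'
      have hnd : ¬ (q : GaussianInt) ∣ r := fun hd => hqp.not_isUnit (hc.isUnit_of_dvd' hd dvd_rfl)
      rw [jacobi_prime hqp, residueSymbol_eq (k := 0) hqp hqo' _ hnd, pow_zero]
      have hr : (r : ZMod q) ≠ 0 := by
        intro h
        rw [ZMod.intCast_zmod_eq_zero_iff_dvd] at h
        apply hnd
        have := map_dvd (Int.castRingHom GaussianInt) h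
        simpa using this
      -- For inert q the exponent (q² − 1)/4 is a multiple of q − 1, so Fermat's theorem for
      -- rational integers suffices.
      have h1 : ((q : GaussianInt).norm.natAbs - 1) / 4 = (q - 1) * ((q + 1) / 4) := by
        rw [Zsqrtd.norm_natCast, Int.natAbs_mul, Int.natAbs_natCast]
        apply Nat.div_eq_of_eq_mul_right (by norm_num)
        obtain ⟨k, hk⟩ : ∃ k, q = 4 * k + 3 := ⟨q / 4, by omega⟩
        rw [hk, show (4 * k + 3 + 1) / 4 = k + 1 by omega]
        rw [show 4 * k + 3 - 1 = 4 * k + 2 by omega]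
        apply Nat.sub_eq_of_eq_add
        ring
      have h2 : (q : ℤ) ∣ r ^ (((q : GaussianInt).norm.natAbs - 1) / 4) - 1 := by
        rw [← ZMod.intCast_zmod_eq_zero_iff_dvd, h1]
        push_cast
        rw [pow_mul, ZMod.pow_card_sub_one_eq_one hr, one_pow, sub_self]
      have := map_dvd (Int.castRingHom GaussianInt) h2
      simpa using this

/-- Both sides are multiplicative: (4e+1)(4f+1) = 4(4ef+e+f)+1, and 4ef does not affect the power of
i. Allowing n or −n to be 4e+1 determines e uniquely and lets the induction pass through primes
congruent to 3 modulo 4. -/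
theorem exists_jacobi_one_add_gaussI {n : ℤ} (hn : Odd n) :
    ∃ e : ℤ, (n = 4 * e + 1 ∨ -n = 4 * e + 1) ∧ quarticJacobiSymbol (1 + gaussI) n = I ^ e := by
  induction n, hn using int_odd_induction with
  | one => exact ⟨0, by simp [jacobi_one]⟩
  | neg n hn ih =>
    obtain ⟨e, he, he'⟩ := ih
    have h0 := odd_norm_ne_zero (odd_norm_intCast hn)
    refine ⟨e, by rw [neg_neg]; exact he.symm, ?_⟩
    push_cast
    rw [jacobi_neg_right h0, he']
  | mul q n hq hqo hn ih =>
    have h0 := odd_norm_ne_zero (odd_norm_intCast hn)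
    have hq0 := odd_norm_ne_zero (odd_norm_intCast hqo)
    have hqo' := odd_norm_intCast hqo
    push_cast at hq0 hqo'
    obtain ⟨e, he, he'⟩ := ih
    suffices h : ∃ f : ℤ, ((q : ℤ) = 4 * f + 1 ∨ -(q : ℤ) = 4 * f + 1) ∧
        quarticJacobiSymbol (1 + gaussI) q = I ^ f by
      obtain ⟨f, hf, hf'⟩ := h
      refine ⟨4 * (e * f) + (e + f), ?_, ?_⟩
      · rcases he with he | he <;> rcases hf with hf | hf
        · left; rw [he, hf]; ring
        · right; rw [← neg_mul, he, hf]; ring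
        · right; rw [← mul_neg, he, hf]; ring
        · left; rw [← neg_mul_neg, he, hf]; ring
      · push_cast
        rw [jacobi_mul_right hq0 h0, he', hf', zpow_add₀ Complex.I_ne_zero, I_zpow_four_mul,
          zpow_add₀ Complex.I_ne_zero]
        ring
    have : q % 4 = 1 ∨ q % 4 = 3 := by
      rw [Int.odd_iff] at hqo; omega
    rcases this with h4 | h4
    · obtain ⟨κ, hκ, hN⟩ := exists_norm_eq hq h4
      have hκo : Odd κ.norm := by rwa [hN]
      refine ⟨q / 4, by omega, ?_⟩
      have hc : IsCoprime (star (1 + gaussI)) κ := by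
        have := isCoprime_one_add_gaussI hκo
        rw [show 1 + gaussI = star (1 + gaussI) * gaussI by decide] at this
        exact this.of_mul_left_left
      -- Since 1 + i = i(1 − i), the symbols at κ and κ̄ are conjugate up to (i/κ), and only that
      -- factor survives in the product.
      have h1 : quarticJacobiSymbol (1 + gaussI) κ =
          quarticJacobiSymbol (star (1 + gaussI)) κ * quarticJacobiSymbol gaussI κ := by
        rw [← jacobi_mul_left hκo]; rfl
      have h2 : quarticJacobiSymbol (1 + gaussI) (star κ) =
          star (quarticJacobiSymbol (star (1 + gaussI)) κ) := by
        rw [← jacobi_star hκo, star_star]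
      rw [jacobi_split hκ hN, h1, h2, jacobi_gaussI hκo (e := q / 4) (by omega), mul_right_comm,
        jacobi_mul_star hκo hc, one_mul]
    · have := Fact.mk hq
      have hqp := GaussianInt.prime_of_nat_prime_of_mod_four_eq_three q h4
      have hc := isCoprime_one_add_gaussI hqo'
      have hnd : ¬ (q : GaussianInt) ∣ 1 + gaussI :=
        fun hd => hqp.not_isUnit (hc.isUnit_of_dvd' hd dvd_rfl)
      obtain ⟨k, hk⟩ : ∃ k, q = 4 * k + 3 := ⟨q / 4, by omega⟩
      refine ⟨-(k + 1), by right; omega, ?_⟩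
      have h1 : ((q : GaussianInt).norm.natAbs - 1) / 4 = (q - 1) * (k + 1) := by
        rw [Zsqrtd.norm_natCast, Int.natAbs_mul, Int.natAbs_natCast]
        apply Nat.div_eq_of_eq_mul_right (by norm_num)
        rw [hk, show 4 * k + 3 - 1 = 4 * k + 2 by omega]
        apply Nat.sub_eq_of_eq_add
        ring
      obtain ⟨r, hr⟩ := exists_add_pow_prime_eq hq (1 : GaussianInt) gaussI
      -- Frobenius gives (1+i)^q ≡ 1 + i^q = 1 − i = i³(1+i) modulo q.
      have h2 : (q : GaussianInt) ∣ (1 + gaussI) ^ (q - 1) - gaussI ^ 3 := by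
        refine (hqp.dvd_or_dvd (b := 1 + gaussI) ⟨gaussI * r, ?_⟩).resolve_right hnd
        have h3 : gaussI ^ q = gaussI ^ 3 := by
          rw [hk, pow_add, pow_mul, gaussI_pow_four, one_pow, one_mul]
        rw [h3, one_pow] at hr
        rw [sub_mul, ← pow_succ, Nat.sub_add_cancel hq.one_le, hr]
        linear_combination -gaussI_pow_four
      rw [jacobi_prime hqp, residueSymbol_eq (k := 3 * (k + 1)) hqp hqo' _ hnd]
      · rw [← zpow_natCast]
        apply I_zpow_congr
        rw [Int.modEq_iff_dvd]
        exact ⟨-(k + 1), by push_cast; ring⟩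
      · rw [h1, pow_mul, pow_mul]
        exact h2.trans (sub_dvd_pow_sub_pow _ _ _)

theorem jacobi_one_add_gaussI {n e : ℤ} (h : n = 4 * e + 1) :
    quarticJacobiSymbol (1 + gaussI) n = I ^ e := by
  obtain ⟨e', he, he'⟩ := exists_jacobi_one_add_gaussI (n := n) ⟨2 * e, by omega⟩
  rw [he', show e' = e by omega]

/-! ### Quartic Gauss sums in characteristic q -/

section GaussSum

variable {p q : ℕ} [Fact p.Prime] [Fact q.Prime] {L : Type*} [Field L]

theorem isQuadratic_sq {χ : MulChar (ZMod p) L} (h4 : χ ^ 4 = 1) : (χ ^ 2).IsQuadratic := by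
  intro a
  by_cases ha : IsUnit a
  · right
    have h1 : χ a ^ 4 = 1 := by
      rw [← MulChar.pow_apply' _ (by norm_num), h4, MulChar.one_apply ha]
    rw [MulChar.pow_apply' _ two_ne_zero]
    exact sq_eq_sq_iff_eq_or_eq_neg.1 (by rw [← pow_mul, one_pow]; exact h1)
  · exact Or.inl (MulChar.map_nonunit _ ha)

theorem apply_neg_one_sq {R : Type*} [CommRing R] (χ : MulChar (ZMod p) R) : χ (-1) ^ 2 = 1 := by
  rw [sq, ← map_mul]; simp

/-- Squaring g(χ)² = J(χ,χ)g(χ²) leaves g(χ²)², which is χ²(−1)p = p because χ² is quadratic. -/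
theorem gaussSum_pow_four {χ : MulChar (ZMod p) L} (h4 : χ ^ 4 = 1) (h2 : χ ^ 2 ≠ 1)
    {ψ : AddChar (ZMod p) L} (hψ : ψ.IsPrimitive) :
    gaussSum χ ψ ^ 4 = jacobiSum χ χ ^ 2 * p := by
  have h := jacobiSum_mul_nontrivial (χ := χ) (φ := χ) (by rwa [← sq]) ψ
  rw [← sq, ← sq] at h
  have h3 := gaussSum_sq h2 (isQuadratic_sq h4) hψ
  rw [MulChar.pow_apply' _ two_ne_zero, apply_neg_one_sq, one_mul, ZMod.card] at h3
  rw [show 4 = 2 * 2 from rfl, pow_mul, ← h, mul_pow, h3, mul_comm]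

theorem exists_isPrimitive [IsAlgClosed L] [CharP L q] (hpq : p ≠ q) :
    ∃ ψ : AddChar (ZMod p) L, ψ.IsPrimitive := by
  have h0 : (p : L) ≠ 0 := by
    rw [Ne, CharP.cast_eq_zero_iff L q, Nat.prime_dvd_prime_iff_eq Fact.out Fact.out]
    exact hpq.symm
  have : NeZero (p : L) := ⟨h0⟩
  obtain ⟨ζ, hζ⟩ := HasEnoughRootsOfUnity.exists_primitiveRoot L p
  exact ⟨_, AddChar.zmodChar_primitive_of_primitive_root p hζ⟩

theorem natCast_ne_zero_of_ne [CharP L q] (hpq : p ≠ q) : (p : L) ≠ 0 := by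
  rw [Ne, CharP.cast_eq_zero_iff L q, Nat.prime_dvd_prime_iff_eq Fact.out Fact.out]
  exact hpq.symm

/-- Frobenius sends g(χ, ψ) to g(χ^q, ψ^q) = g(χ, ψ^q), and a change of variable gives χ(q)g^q = g.
Cancel g and write g^(q−1) as a power of g⁴. -/
theorem jacobiSum_pow_of_mod_four_eq_one [IsAlgClosed L] [CharP L q] (hpq : p ≠ q)
    {χ : MulChar (ZMod p) L} (h4 : χ ^ 4 = 1) (h2 : χ ^ 2 ≠ 1) (hq : q % 4 = 1) :
    χ q * (jacobiSum χ χ ^ 2 * p) ^ (q / 4) = 1 := by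
  obtain ⟨ψ, hψ⟩ := exists_isPrimitive (p := p) (q := q) (L := L) hpq
  have h1 : χ ≠ 1 := by rintro rfl; simp at h2
  have hpL := natCast_ne_zero_of_ne (L := L) hpq
  have hg := gaussSum_ne_zero_of_nontrivial (by rwa [ZMod.card]) h1 hψ
  have hu : IsUnit (q : ZMod p) := (natCast_ne_zero_of_ne (L := ZMod p) hpq.symm).isUnit
  have hf := gaussSum_frob q χ ψ
  have hχ : χ ^ q = χ := by
    rw [← Nat.div_add_mod q 4, hq, pow_add, pow_mul, h4, one_pow, one_mul, pow_one]
  have hs := gaussSum_mulShift χ ψ hu.unit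
  rw [hχ, AddChar.pow_mulShift] at hf
  rw [hu.unit_spec, ← hf] at hs
  apply mul_right_cancel₀ hg
  rw [one_mul, ← gaussSum_pow_four h4 h2 hψ, ← pow_mul, mul_assoc, ← pow_succ]
  convert hs using 3
  omega

/-- Here χ^q = χ⁻¹, so Frobenius takes g(χ) to a multiple of g(χ⁻¹). Multiplying once more by g(χ)
gives g^(q+1) in terms of g(χ)g(χ⁻¹) = χ(−1)p. -/
theorem jacobiSum_pow_of_mod_four_eq_three [IsAlgClosed L] [CharP L q] (hpq : p ≠ q)
    {χ : MulChar (ZMod p) L} (h4 : χ ^ 4 = 1) (h2 : χ ^ 2 ≠ 1) (hq : q % 4 = 3) :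
    (jacobiSum χ χ ^ 2 * p) ^ (q / 4 + 1) = χ q * χ (-1) * p := by
  obtain ⟨ψ, hψ⟩ := exists_isPrimitive (p := p) (q := q) (L := L) hpq
  have h1 : χ ≠ 1 := by rintro rfl; simp at h2
  have hu : IsUnit (q : ZMod p) := (natCast_ne_zero_of_ne (L := ZMod p) hpq.symm).isUnit
  have hf := gaussSum_frob q χ ψ
  have hχ : χ ^ q = χ⁻¹ := by
    rw [← Nat.div_add_mod q 4, hq, pow_add, pow_mul, h4, one_pow, one_mul,
      eq_inv_iff_mul_eq_one, ← pow_succ, h4]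
  have hs := gaussSum_mulShift χ⁻¹ ψ hu.unit
  rw [hχ, AddChar.pow_mulShift] at hf
  rw [hu.unit_spec, ← hf] at hs
  have hm := mul_gaussSum_inv_eq_gaussSum χ⁻¹ ψ
  have hc := gaussSum_mul_gaussSum_eq_card h1 hψ
  rw [ZMod.card] at hc
  have hi : ∀ a : ZMod p, IsUnit a → χ a * χ⁻¹ a = 1 := fun a ha => by
    rw [← MulChar.mul_apply, mul_inv_cancel, MulChar.one_apply ha]
  have hi1 : χ⁻¹ (-1) = χ (-1) := by
    have h3 := hi (-1) isUnit_one.neg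
    have h5 := apply_neg_one_sq χ
    have h6 : χ (-1) ≠ 0 := fun h => by rw [h] at h5; norm_num at h5
    apply mul_left_cancel₀ h6
    rw [h3, ← sq, h5]
  rw [← gaussSum_pow_four h4 h2 hψ, ← pow_mul, show 4 * (q / 4 + 1) = q + 1 by omega]
  have h3 := hi q hu
  rw [hi1] at hm
  calc gaussSum χ ψ ^ (q + 1) = χ q * (χ⁻¹ q * gaussSum χ ψ ^ q) * gaussSum χ ψ := by
        rw [← mul_assoc, h3, one_mul, pow_succ]
    _ = χ q * χ (-1) * (gaussSum χ ψ * gaussSum χ⁻¹ ψ⁻¹) := by rw [hs, ← hm]; ring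
    _ = _ := by rw [hc]

end GaussSum

/-! ### The quartic character of a split prime and its Jacobi sum -/

theorem gaussI_pow_sum_eq_zero {p k : ℕ} [Fact p.Prime] (hk : 4 * k = p - 1) :
    ∑ x : ZMod p, x ^ k * (1 - x) ^ k = 0 := by
  have hp := (Fact.out : p.Prime).two_le
  have h : ∀ x : ZMod p, x ^ k * (1 - x) ^ k =
      ∑ m ∈ Finset.range (k + 1), x ^ (k + (k - m)) * ((-1) ^ (k - m) * (k.choose m : ZMod p)) :=
    fun x => by
      rw [sub_eq_add_neg, add_pow, Finset.mul_sum]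
      refine Finset.sum_congr rfl fun m _ => ?_
      rw [one_pow, neg_pow x, pow_add]
      ring
  simp only [h]
  rw [Finset.sum_comm]
  refine Finset.sum_eq_zero fun m _ => ?_
  -- All exponents are at most 2k < p − 1, so each power sum over the field vanishes.
  rw [← Finset.sum_mul, FiniteField.sum_pow_lt_card_sub_one, zero_mul]
  rw [ZMod.card]
  omega

/-- The quartic residue character modulo a split Gaussian prime. -/
theorem exists_quarticChar {π : GaussianInt} {p : ℕ} [Fact p.Prime] (hN : π.norm = p)
    (hp : p % 4 = 1) : ∃ (f : GaussianInt →+* ZMod p) (χ : MulChar (ZMod p) GaussianInt),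
      f π = 0 ∧ (∀ t, f (χ t) = t ^ ((p - 1) / 4)) ∧ ∀ t, t ≠ 0 → ∃ k : ℕ, χ t = gaussI ^ k := by
  obtain ⟨f, hf⟩ := exists_hom_zmod hN
  have hπ := prime_of_norm_prime Fact.out hN
  have ho : Odd π.norm := by rw [hN, Int.odd_iff]; omega
  have hk0 : (p - 1) / 4 ≠ 0 := by
    have := (Fact.out : p.Prime).two_le; omega
  have hex : ∀ t : ZMod p, ∃ w : GaussianInt, f w = t ^ ((p - 1) / 4) ∧
      (t ≠ 0 → ∃ k : ℕ, w = gaussI ^ k) ∧ (t = 0 → w = 0) := by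
    intro t
    by_cases ht : t = 0
    · exact ⟨0, by rw [ht, map_zero, zero_pow hk0], fun h => absurd ht h, fun _ => rfl⟩
    · have hft : f (t.val : GaussianInt) = t := by rw [map_natCast, ZMod.natCast_zmod_val]
      have h1 : ¬ π ∣ (t.val : GaussianInt) := by rwa [← hom_eq_zero_iff f hπ hf, hft]
      obtain ⟨k, hk⟩ := exists_pow_sub_gaussI_pow hπ ho h1
      rw [← hom_eq_zero_iff f hπ hf, map_sub, map_pow, hft, hN, Int.natAbs_natCast,
        sub_eq_zero] at hk
      exact ⟨gaussI ^ k, hk.symm, fun _ => ⟨k, rfl⟩, fun h => absurd h ht⟩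
  choose w hw hw1 hw0 using hex
  -- Reduction modulo π is injective on fourth roots of unity, so multiplicativity of the lifted
  -- values follows from that of t ↦ t^((p−1)/4).
  have hinj : ∀ k l : ℕ, f (gaussI ^ k) = f (gaussI ^ l) → gaussI ^ k = gaussI ^ l := by
    intro k l h
    rw [← I_pow_eq_iff]
    apply gaussI_pow_inj hπ ho
    rw [← hom_eq_zero_iff f hπ hf, map_sub, h, sub_self]
  refine ⟨f, ⟨⟨⟨w, ?_⟩, ?_⟩, ?_⟩, hf, hw, hw1⟩
  · obtain ⟨k, hk⟩ := hw1 1 one_ne_zero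
    rw [hk, ← pow_zero gaussI]
    apply hinj
    rw [← hk, hw]; simp
  · intro s t
    simp only
    by_cases hs : s = 0
    · rw [hs, zero_mul, hw0 0 rfl, zero_mul]
    by_cases ht : t = 0
    · rw [ht, mul_zero, hw0 0 rfl, mul_zero]
    obtain ⟨k, hk⟩ := hw1 s hs
    obtain ⟨l, hl⟩ := hw1 t ht
    obtain ⟨m, hm⟩ := hw1 (s * t) (mul_ne_zero hs ht)
    rw [hk, hl, hm, ← pow_add]
    apply hinj
    rw [← hm, hw, pow_add, map_mul, ← hk, ← hl, hw, hw, mul_pow]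
  · intro t ht
    exact hw0 t (by simpa using ht)

section CharacterFacts

variable {π : GaussianInt} {p : ℕ} [Fact p.Prime] {f : GaussianInt →+* ZMod p}
  {χ : MulChar (ZMod p) GaussianInt}

theorem quarticChar_pow_four (hχ : ∀ t, t ≠ 0 → ∃ k : ℕ, χ t = gaussI ^ k) : χ ^ 4 = 1 := by
  apply MulChar.ext
  intro a
  obtain ⟨k, hk⟩ := hχ a a.ne_zero
  rw [MulChar.pow_apply_coe, hk, ← pow_mul, mul_comm, pow_mul, gaussI_pow_four, one_pow,
    MulChar.one_apply_coe]

theorem residueSymbol_eq_quarticChar (hN : π.norm = p) (hp : p % 4 = 1) (hf : f π = 0)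
    (hfχ : ∀ t, f (χ t) = t ^ ((p - 1) / 4)) {α : GaussianInt} {k : ℕ} (hk : χ (f α) = gaussI ^ k) :
    quarticResidueSymbol α π = I ^ k := by
  have hπ := prime_of_norm_prime Fact.out hN
  have ho : Odd π.norm := by rw [hN, Int.odd_iff]; omega
  refine residueSymbol_eq hπ ho ?_ ?_
  · rw [← hom_eq_zero_iff f hπ hf, map_sub, ← hk, hfχ, map_pow, hN, Int.natAbs_natCast, sub_self]
  · rw [← hom_eq_zero_iff f hπ hf]
    intro h
    rw [h, MulChar.map_zero] at hk
    exact pow_ne_zero k (by decide) hk.symm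

/-- A quadratic nonresidue works, by Euler's criterion. It witnesses that χ² is nontrivial, both in
ℤ[i] and after mapping to odd characteristic. -/
theorem exists_quarticChar_sq_eq_neg_one (hp : p % 4 = 1)
    (hfχ : ∀ t, f (χ t) = t ^ ((p - 1) / 4)) (hχ : ∀ t, t ≠ 0 → ∃ k : ℕ, χ t = gaussI ^ k) :
    ∃ t : ZMod p, t ≠ 0 ∧ χ t ^ 2 = -1 := by
  have hp2 : ringChar (ZMod p) ≠ 2 := by rw [ZMod.ringChar_zmod_n]; omega
  obtain ⟨t, ht⟩ := FiniteField.exists_nonsquare hp2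
  have h0 : t ≠ 0 := by rintro rfl; exact ht (IsSquare.zero)
  rw [ZMod.euler_criterion p h0] at ht
  refine ⟨t, h0, ?_⟩
  obtain ⟨k, hk⟩ := hχ t h0
  rw [hk, ← pow_mul, mul_comm, pow_mul, gaussI_sq]
  refine (neg_one_pow_eq_or _ k).resolve_left fun h => ht ?_
  have h1 : χ t ^ 2 = 1 := by rw [hk, ← pow_mul, mul_comm, pow_mul, gaussI_sq, h]
  have h2 := congrArg f h1
  rw [map_pow, hfχ, map_one, ← pow_mul] at h2
  rw [← h2]
  congr 1
  omega

theorem isPrimitiveRoot_gaussI : IsPrimitiveRoot gaussI 4 :=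
  IsPrimitiveRoot.mk_of_lt _ (by norm_num) gaussI_pow_four fun l h0 h4 => by
    interval_cases l <;> decide

theorem star_quarticChar (hχ : ∀ t, t ≠ 0 → ∃ k : ℕ, χ t = gaussI ^ k) :
    χ.ringHomComp (starRingEnd GaussianInt) = χ⁻¹ := by
  rw [eq_inv_iff_mul_eq_one]
  apply MulChar.ext
  intro a
  obtain ⟨k, hk⟩ := hχ a a.ne_zero
  rw [MulChar.mul_apply, MulChar.one_apply_coe, MulChar.ringHomComp_apply, hk, map_pow, ← mul_pow]
  rw [show starRingEnd GaussianInt gaussI * gaussI = 1 by decide, one_pow]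

/-- Up to sign, the Jacobi sum of a quartic residue character is the Gaussian prime itself,
normalized to be congruent to a unit rational integer modulo `2`. -/
theorem jacobiSum_quarticChar (hN : π.norm = p) (hp : p % 4 = 1) (hf : f π = 0)
    (hfχ : ∀ t, f (χ t) = t ^ ((p - 1) / 4)) (hχ : ∀ t, t ≠ 0 → ∃ k : ℕ, χ t = gaussI ^ k)
    (him : Even π.im) : (jacobiSum χ χ = π ∨ jacobiSum χ χ = -π) ∧
      jacobiSum χ χ * star (jacobiSum χ χ) = p := by
  have hπ := prime_of_norm_prime Fact.out hN
  have h4 := quarticChar_pow_four hχ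
  obtain ⟨t, ht0, ht⟩ := exists_quarticChar_sq_eq_neg_one hp hfχ hχ
  have h2 : χ ^ 2 ≠ 1 := by
    intro h
    have := congrArg (fun φ : MulChar (ZMod p) GaussianInt => φ t) h
    simp only [MulChar.pow_apply' _ two_ne_zero, ht, MulChar.one_apply ht0.isUnit] at this
    exact absurd this (by decide)
  have h1 : χ ≠ 1 := by rintro rfl; simp at h2
  have hmul : jacobiSum χ χ * star (jacobiSum χ χ) = p := by
    have hinj := GaussianInt.toComplex_injective
    have hne : ringChar ℂ ≠ ringChar (ZMod p) := by
      rw [ZMod.ringChar_zmod_n, (CharP.ringChar_zero_iff_CharZero ℂ).2 inferInstance]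
      exact (Fact.out : p.Prime).ne_zero.symm
    have hc := (MulChar.ringHomComp_ne_one_iff hinj).2 h1
    have := jacobiSum_mul_jacobiSum_inv hne hc hc (by
      rw [← sq, MulChar.ringHomComp_pow]; exact (MulChar.ringHomComp_ne_one_iff hinj).2 h2)
    rw [MulChar.ringHomComp_inv, jacobiSum_ringHomComp, jacobiSum_ringHomComp,
      ← star_quarticChar hχ, jacobiSum_ringHomComp, ← map_mul, ZMod.card] at this
    apply hinj
    rw [map_natCast, ← this]
    rfl
  refine ⟨?_, hmul⟩
  -- Modulo π the Jacobi sum becomes a sum of x^k(1−x)^k with k = (p−1)/4. It vanishes, and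
  -- comparing norms then makes J an associate of π.
  have hd : π ∣ jacobiSum χ χ := by
    rw [← hom_eq_zero_iff f hπ hf, jacobiSum, map_sum]
    simp only [map_mul, hfχ]
    exact gaussI_pow_sum_eq_zero (by omega)
  obtain ⟨w, hw⟩ := hd
  have hwu : IsUnit w := by
    have hn : (jacobiSum χ χ).norm = p := by
      have := Zsqrtd.norm_eq_mul_conj (jacobiSum χ χ)
      rw [hmul] at this
      exact_mod_cast this
    rw [hw, Zsqrtd.norm_mul, hN] at hn
    rw [← Zsqrtd.norm_eq_one_iff' (by norm_num)]
    have hp0 : (p : ℤ) ≠ 0 := by exact_mod_cast (Fact.out : p.Prime).ne_zero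
    exact mul_left_cancel₀ hp0 (by rw [hn, mul_one])
  -- J ≡ −1 modulo (i − 1)² = −2i, so its imaginary part is even; this excludes the units ±i.
  have hJ : Even (jacobiSum χ χ).im := by
    obtain ⟨z, -, hz⟩ := exists_jacobiSum_eq_neg_one_add (n := 4) (by norm_num) h4 h4
      (by rw [ZMod.card]; omega) isPrimitiveRoot_gaussI
    rw [hz, show (gaussI - 1) ^ 2 = ((-2 : ℤ) : GaussianInt) * gaussI by
      push_cast; linear_combination gaussI_sq]
    refine ⟨-z.re, ?_⟩
    simp [gaussI]
    ring
  rw [hw] at hJ ⊢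
  rw [← Zsqrtd.norm_eq_one_iff' (by norm_num), norm_eq] at hwu
  have hre : Odd π.re := by
    have h3 : Odd π.norm := by rw [hN, Int.odd_iff]; omega
    rw [norm_eq, Int.odd_add] at h3
    by_contra h5
    rw [Int.not_odd_iff_even] at h5
    have := (him.pow_of_ne_zero two_ne_zero)
    have h6 := h3.2 this
    rw [Int.odd_pow' two_ne_zero, ← Int.not_even_iff_odd] at h6
    exact h6 h5
  have hwim : Even w.im := by
    rw [Zsqrtd.im_mul, Int.even_add, Int.even_mul, Int.even_mul] at hJ
    rw [← Int.not_even_iff_odd] at hre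
    tauto
  have hwim0 : w.im = 0 := by
    obtain ⟨m, hm⟩ := hwim
    have : w.im ^ 2 ≤ 1 := by nlinarith [sq_nonneg w.re]
    have h7 : w.im ≤ 1 := by nlinarith
    have h8 : -1 ≤ w.im := by nlinarith
    omega
  have hwre : w.re = 1 ∨ w.re = -1 := by
    rw [hwim0] at hwu
    exact sq_eq_sq_iff_eq_or_eq_neg.1 (by rw [one_pow]; linarith)
  rcases hwre with h | h
  · left
    rw [show w = 1 from Zsqrtd.ext h hwim0, mul_one]
  · right
    rw [show w = -1 from Zsqrtd.ext (by rw [h]; simp) (by rw [hwim0]; simp), mul_neg_one]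

end CharacterFacts

/-! ### Reciprocity between rational and Gaussian integers -/

theorem I_pow_eq_of_hom {R : Type*} [CommRing R] [Nontrivial R] (φ : GaussianInt →+* R)
    {κ : GaussianInt} (hκ : Prime κ) (ho : Odd κ.norm) (hφ : φ κ = 0) {k l : ℕ}
    (h : φ (gaussI ^ k) = φ (gaussI ^ l)) : I ^ k = I ^ l := by
  apply gaussI_pow_inj hκ ho
  rw [← hom_eq_zero_iff φ hκ hφ, map_sub, h, sub_self]

theorem exists_residueSymbol_hom {R : Type*} [CommRing R] [Nontrivial R] (φ : GaussianInt →+* R)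
    {κ : GaussianInt} (hκ : Prime κ) (ho : Odd κ.norm) (hφ : φ κ = 0) {α : GaussianInt}
    (h : φ α ≠ 0) : ∃ k : ℕ, quarticResidueSymbol α κ = I ^ k ∧
      φ α ^ ((κ.norm.natAbs - 1) / 4) = φ (gaussI ^ k) := by
  rw [Ne, hom_eq_zero_iff φ hκ hφ] at h
  obtain ⟨k, hk, hk'⟩ := exists_residueSymbol_eq hκ ho h
  rw [← hom_eq_zero_iff φ hκ hφ, map_sub, map_pow, sub_eq_zero] at hk'
  exact ⟨k, hk, hk'⟩

theorem jacobi_neg_left_intCast {n : ℤ} (hn : Odd n) (α : GaussianInt) :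
    quarticJacobiSymbol (-α) n = quarticJacobiSymbol α n := by
  have h7 : quarticJacobiSymbol (-1) n = 1 := by
    have := jacobi_intCast (n := n) (r := -1) hn (by push_cast; exact isCoprime_one_left.neg_left)
    simpa using this
  rw [← neg_one_mul, jacobi_mul_left (odd_norm_intCast hn), h7, one_mul]

section Split

variable {π : GaussianInt} {p q : ℕ} [Fact p.Prime]

theorem ringHomComp_sq_ne_one {L : Type*} [Field L] [CharP L q] (hq : q ≠ 2)
    (φ : GaussianInt →+* L) {χ : MulChar (ZMod p) GaussianInt} {t : ZMod p} (ht0 : t ≠ 0)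
    (ht : χ t ^ 2 = -1) : χ.ringHomComp φ ^ 2 ≠ 1 := by
  intro h
  have h1 := congrArg (fun ω : MulChar (ZMod p) L => ω t) h
  simp only [MulChar.pow_apply' _ two_ne_zero, MulChar.ringHomComp_apply,
    MulChar.one_apply ht0.isUnit] at h1
  rw [← map_pow, ht, map_neg, map_one] at h1
  have h2 : ringChar L ≠ 2 := by rwa [ringChar.eq L q]
  exact Ring.neg_one_ne_one_of_char_ne_two h2 h1

/-- Modulo a prime κ above q, the Gauss sum relation with p = JJ̄ reads
χ(q)·J^(3(q−1)/4)·J̄^((q−1)/4) ≡ 1. Since (J/κ)³ is the inverse of (J/κ) and (J̄/κ) is conjugate to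
(J/κ̄), this says (q/π) = (J/κ)(J/κ̄) = (J/q), and J = ±π. -/
theorem reciprocity_split_one [Fact q.Prime] (hN : π.norm = p) (hp : p % 4 = 1) (him : Even π.im)
    (hpq : p ≠ q) (hq : q % 4 = 1) : quarticJacobiSymbol q π = quarticJacobiSymbol π q := by
  have hπ := prime_of_norm_prime Fact.out hN
  obtain ⟨f, χ, hf, hfχ, hχ⟩ := exists_quarticChar hN hp
  obtain ⟨hJ, hJJ⟩ := jacobiSum_quarticChar hN hp hf hfχ hχ him
  obtain ⟨t, ht0, ht⟩ := exists_quarticChar_sq_eq_neg_one hp hfχ hχ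
  obtain ⟨κ, hκ, hκN⟩ := exists_norm_eq (q := q) Fact.out hq
  have hκo : Odd κ.norm := by rw [hκN, Int.odd_iff]; omega
  obtain ⟨ψ, hψ⟩ := exists_hom_zmod hκN
  set φ : GaussianInt →+* AlgebraicClosure (ZMod q) := (algebraMap _ _).comp ψ with hφ
  have hφκ : φ κ = 0 := by rw [hφ, RingHom.comp_apply, hψ, map_zero]
  have : CharP (AlgebraicClosure (ZMod q)) q := charP_of_injective_algebraMap' (ZMod q) q
  have h4 : χ.ringHomComp φ ^ 4 = 1 := by
    rw [MulChar.ringHomComp_pow, quarticChar_pow_four hχ, MulChar.ringHomComp_one]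
  have h2 := ringHomComp_sq_ne_one (q := q) (by omega) φ ht0 ht
  have key := jacobiSum_pow_of_mod_four_eq_one hpq h4 h2 hq
  rw [jacobiSum_ringHomComp, MulChar.ringHomComp_apply] at key
  set J := jacobiSum χ χ
  have hpL : φ (J * star J) ≠ 0 := by
    rw [hJJ, map_natCast]
    exact natCast_ne_zero_of_ne hpq
  rw [map_mul] at hpL
  have hq4 : (κ.norm.natAbs - 1) / 4 = q / 4 := by rw [hκN, Int.natAbs_natCast]; omega
  obtain ⟨a, ha, ha'⟩ := exists_residueSymbol_hom φ hκ hκo hφκ (left_ne_zero_of_mul hpL)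
  obtain ⟨b, hb, hb'⟩ := exists_residueSymbol_hom φ hκ hκo hφκ (right_ne_zero_of_mul hpL)
  obtain ⟨c, hc⟩ := hχ q (natCast_ne_zero_of_ne (q := p) hpq.symm)
  rw [hq4] at ha' hb'
  have hpp : (p : AlgebraicClosure (ZMod q)) = φ J * φ (star J) := by
    rw [← map_mul, hJJ, map_natCast]
  have h5 : φ (gaussI ^ (c + (3 * a + b))) = φ (gaussI ^ 0) := by
    rw [pow_zero, map_one, ← key, hc, hpp, pow_add, map_mul]
    congr 1
    rw [← mul_assoc, ← pow_succ, mul_pow, hb', ← pow_mul, mul_comm _ (q / 4), pow_mul, ha', pow_add,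
      map_mul, mul_comm 3 a, pow_mul, map_pow]
  have h6 := I_pow_eq_of_hom φ hκ hκo hφκ h5
  have hs1 : quarticJacobiSymbol q π = I ^ c := by
    rw [jacobi_prime hπ]
    exact residueSymbol_eq_quarticChar hN hp hf hfχ (by rw [map_natCast, hc])
  have hsJ : quarticJacobiSymbol J q = I ^ a * star (I ^ b) := by
    rw [jacobi_split hκ hκN, jacobi_prime hκ, ha, jacobi_prime (prime_star hκ)]
    rw [← hb, ← residueSymbol_star hκ hκo, star_star]
  have hqo : Odd (q : ℤ) := by rw [Int.odd_iff]; omega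
  have hqo' := odd_norm_intCast hqo
  push_cast at hqo'
  have hsπ : quarticJacobiSymbol π q = quarticJacobiSymbol J q := by
    rcases hJ with h | h
    · rw [h]
    · have := jacobi_neg_left_intCast hqo π
      push_cast at this
      rw [h, this]
  rw [hs1, hsπ, hsJ]
  have hb1 : I ^ b * star (I ^ b) = 1 := by rw [star_pow, ← mul_pow]; simp
  have ha4 : (I ^ a) ^ 4 = 1 := by rw [← pow_mul, mul_comm, I_pow_four_mul]
  rw [pow_add, pow_add, mul_comm 3 a, pow_mul] at h6
  calc I ^ c = I ^ c * ((I ^ a) ^ 4) * (I ^ b * star (I ^ b)) := by rw [ha4, hb1]; ring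
    _ = (I ^ c * ((I ^ a) ^ 3 * I ^ b)) * (I ^ a * star (I ^ b)) := by ring
    _ = I ^ a * star (I ^ b) := by rw [h6]; ring

/-- Modulo the inert q, conjugation is Frobenius, so p = JJ̄ ≡ J^(q+1). The Gauss sum relation
collapses to J^((q²−1)/4) ≡ χ(−q), whose left side defines (J/q). -/
theorem reciprocity_split_three [Fact q.Prime] (hN : π.norm = p) (hp : p % 4 = 1) (him : Even π.im)
    (hpq : p ≠ q) (hq : q % 4 = 3) : quarticJacobiSymbol (-q) π = quarticJacobiSymbol π q := by
  have hπ := prime_of_norm_prime Fact.out hN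
  obtain ⟨f, χ, hf, hfχ, hχ⟩ := exists_quarticChar hN hp
  obtain ⟨hJ, hJJ⟩ := jacobiSum_quarticChar hN hp hf hfχ hχ him
  obtain ⟨t, ht0, ht⟩ := exists_quarticChar_sq_eq_neg_one hp hfχ hχ
  have hκ := GaussianInt.prime_of_nat_prime_of_mod_four_eq_three q hq
  have hqo : Odd (q : ℤ) := by rw [Int.odd_iff]; omega
  have hqo' := odd_norm_intCast hqo
  push_cast at hqo'
  obtain ⟨r, hr⟩ := IsAlgClosed.exists_pow_nat_eq (-1 : AlgebraicClosure (ZMod q)) two_pos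
  have : CharP (AlgebraicClosure (ZMod q)) q := charP_of_injective_algebraMap' (ZMod q) q
  set φ := homOfSq r (by rw [← sq, hr]) with hφ
  have hφκ : φ q = 0 := by rw [map_natCast, CharP.cast_eq_zero]
  have h4 : χ.ringHomComp φ ^ 4 = 1 := by
    rw [MulChar.ringHomComp_pow, quarticChar_pow_four hχ, MulChar.ringHomComp_one]
  have h2 := ringHomComp_sq_ne_one (q := q) (by omega) φ ht0 ht
  have key := jacobiSum_pow_of_mod_four_eq_three hpq h4 h2 hq
  rw [jacobiSum_ringHomComp, MulChar.ringHomComp_apply, MulChar.ringHomComp_apply] at key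
  set J := jacobiSum χ χ
  have hpL : φ (J * star J) ≠ 0 := by
    rw [hJJ, map_natCast]
    exact natCast_ne_zero_of_ne hpq
  rw [map_mul] at hpL
  have hJ0 := left_ne_zero_of_mul hpL
  have hstar : φ (star J) = φ J ^ q := by
    have hint : ∀ z : ℤ, (z : AlgebraicClosure (ZMod q)) ^ q = z := fun z => by
      have := congrArg (algebraMap (ZMod q) (AlgebraicClosure (ZMod q))) (ZMod.pow_card (z : ZMod q))
      rwa [map_pow, map_intCast] at this
    have hrq : r ^ q = -r := by
      have hq2 : r ^ q = r ^ (2 * (2 * (q / 4) + 1) + 1) := by congr 1; omega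
      rw [hq2, pow_succ, pow_mul, hr, pow_succ, pow_mul]
      norm_num
    rw [hφ, homOfSq_apply, homOfSq_apply, add_pow_char, mul_pow, hint, hint, hrq]
    simp
  have hpp : (p : AlgebraicClosure (ZMod q)) = φ J ^ (q + 1) := by
    rw [pow_succ', ← hstar, ← map_mul, hJJ, map_natCast]
  obtain ⟨a, ha, ha'⟩ := exists_residueSymbol_hom φ hκ hqo' hφκ hJ0
  obtain ⟨b, hb⟩ := hχ (-q) (neg_ne_zero.2 (natCast_ne_zero_of_ne (q := p) hpq.symm))
  obtain ⟨k, hk⟩ : ∃ k, q = 4 * k + 3 := ⟨q / 4, by omega⟩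
  have hq4 : ((q : GaussianInt).norm.natAbs - 1) / 4 + (q + 1) = (2 + (q + 1)) * (q / 4 + 1) := by
    have h1 : ((q : GaussianInt).norm.natAbs - 1) / 4 = (4 * k + 2) * (k + 1) := by
      rw [Zsqrtd.norm_natCast, Int.natAbs_mul, Int.natAbs_natCast]
      apply Nat.div_eq_of_eq_mul_right (by norm_num)
      rw [hk]
      apply Nat.sub_eq_of_eq_add
      ring
    rw [h1, show q / 4 = k by omega, hk]
    ring
  have h5 : φ (gaussI ^ a) = φ (gaussI ^ b) := by
    rw [← ha', ← hb]
    apply mul_right_cancel₀ (pow_ne_zero (q + 1) hJ0)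
    rw [← pow_add, hq4, pow_mul, pow_add (φ J) 2, ← hpp, key, ← map_mul, ← map_mul, mul_neg_one]
  have h6 := I_pow_eq_of_hom φ hκ hqo' hφκ h5
  have hs1 : quarticJacobiSymbol (-q) π = I ^ b := by
    rw [jacobi_prime hπ]
    exact residueSymbol_eq_quarticChar hN hp hf hfχ (by rw [map_neg, map_natCast, hb])
  have hsπ : quarticJacobiSymbol π q = quarticJacobiSymbol J q := by
    rcases hJ with h | h
    · rw [h]
    · have := jacobi_neg_left_intCast hqo π
      push_cast at this
      rw [h, this]
  rw [hs1, hsπ, jacobi_prime hκ, ha, h6]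

end Split

theorem eq_one_or_neg_one_of_isUnit {u : GaussianInt} (hu : IsUnit u) (him : Even u.im) :
    u = 1 ∨ u = -1 := by
  have hun := (Zsqrtd.norm_eq_one_iff' (by norm_num) u).2 hu
  rw [norm_eq] at hun
  obtain ⟨m, hm⟩ := him
  have h7 : u.im ≤ 1 := by nlinarith [sq_nonneg u.re]
  have h8 : -1 ≤ u.im := by nlinarith [sq_nonneg u.re]
  have h0 : u.im = 0 := by omega
  have hre : u.re = 1 ∨ u.re = -1 := by
    rw [h0] at hun
    exact sq_eq_sq_iff_eq_or_eq_neg.1 (by rw [one_pow]; linarith)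
  rcases hre with h | h
  · exact Or.inl (Zsqrtd.ext h h0)
  · exact Or.inr (Zsqrtd.ext (by rw [h]; simp) (by rw [h0]; simp))

/-- Quartic reciprocity between an odd rational prime and a Gaussian prime with odd real part. -/
theorem reciprocity_prime {π : GaussianInt} (hπ : Prime π) (ho : Odd π.norm) (him : Even π.im)
    {q : ℕ} (hq : q.Prime) (hqo : Odd (q : ℤ)) (hc : IsCoprime π q) {s : ℤ} (hs : s = 1 ∨ s = -1)
    (hsq : (s * q) % 4 = 1) :
    quarticJacobiSymbol ((s * q : ℤ) : GaussianInt) π = quarticJacobiSymbol π q := by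
  have := Fact.mk hq
  rcases prime_cases hπ ho with ⟨p, hp, hN, hp1⟩ | ⟨l, hl, hl3, ha⟩
  · have := Fact.mk hp
    have hpq : p ≠ q := by
      rintro rfl
      refine hπ.not_isUnit (hc.isUnit_of_dvd' dvd_rfl ?_)
      rw [← Int.cast_natCast, ← hN, Zsqrtd.norm_eq_mul_conj]
      exact dvd_mul_right _ _
    have : q % 4 = 1 ∨ q % 4 = 3 := by
      rw [Int.odd_iff] at hqo; omega
    rcases this with h4 | h4
    · have hs1 : s = 1 := by rcases hs with rfl | rfl <;> omega
      rw [hs1, ← reciprocity_split_one hN hp1 him hpq h4]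
      push_cast; rw [one_mul]
    · have hs1 : s = -1 := by rcases hs with rfl | rfl <;> omega
      rw [hs1, ← reciprocity_split_three hN hp1 him hpq h4]
      push_cast; rw [neg_one_mul]
  -- An inert π with even imaginary part is ±l with l rational, and both symbols are then 1.
  · obtain ⟨u, hu⟩ := ha.symm
    have hlo : Odd (l : ℤ) := by rw [Int.odd_iff]; omega
    have hl0 := odd_norm_ne_zero (odd_norm_intCast hlo)
    push_cast at hl0
    have hπl : π = l ∨ π = -l := by
      have h1 : π.im = l * (u : GaussianInt).im := by rw [← hu]; simp
      have h2 : Even (u : GaussianInt).im := by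
        rw [h1, Int.even_mul, ← Int.not_odd_iff_even] at him
        tauto
      rw [← hu]
      rcases eq_one_or_neg_one_of_isUnit u.isUnit h2 with h | h <;> simp [h]
    have hc' : IsCoprime (l : GaussianInt) q := by
      rcases hπl with h | h
      · rwa [h] at hc
      · rwa [h, IsCoprime.neg_left_iff] at hc
    have hsu : IsUnit (s : GaussianInt) := by
      rcases hs with rfl | rfl <;> simp
    have h1 : quarticJacobiSymbol (l : GaussianInt) q = 1 := by
      have := jacobi_intCast (n := q) (r := l) hqo (by push_cast; exact hc')
      simpa using this
    have h2 : quarticJacobiSymbol ((s * q : ℤ) : GaussianInt) l = 1 := by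
      have := jacobi_intCast (n := l) (r := s * q) hlo (by
        push_cast; exact (isCoprime_mul_unit_left_left hsu _ _).2 hc'.symm)
      simpa using this
    rcases hπl with h | h
    · rw [h, h1, h2]
    · rw [h, jacobi_neg_right hl0, h2]
      have := jacobi_neg_left_intCast (n := q) hqo l
      push_cast at this
      rw [this, h1]

theorem exists_sign {n : ℤ} (h : Odd n) : ∃ s : ℤ, (s = 1 ∨ s = -1) ∧ (s * n) % 4 = 1 := by
  rw [Int.odd_iff] at h
  have : n % 4 = 1 ∨ n % 4 = 3 := by omega
  rcases this with h | h
  · exact ⟨1, Or.inl rfl, by omega⟩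
  · exact ⟨-1, Or.inr rfl, by omega⟩

theorem odd_re_of_even_im {β : GaussianInt} (ho : Odd β.norm) (him : Even β.im) : Odd β.re := by
  by_contra h
  rw [Int.not_odd_iff_even] at h
  rw [norm_eq, ← Int.not_even_iff_odd] at ho
  exact ho ((h.pow_of_ne_zero two_ne_zero).add (him.pow_of_ne_zero two_ne_zero))

theorem jacobi_one_left {β : GaussianInt} (h : Odd β.norm) : quarticJacobiSymbol 1 β = 1 := by
  have h1 := jacobi_mul_left h 1 1
  rw [one_mul] at h1
  exact mul_left_cancel₀ (jacobi_ne_zero h isCoprime_one_left) (by rw [← h1, mul_one])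

theorem even_im_of_mul {α β : GaussianInt} (hα : Odd α.norm) (h : Even α.im)
    (hm : Even (α * β).im) : Even β.im := by
  have hre := odd_re_of_even_im hα h
  rw [Zsqrtd.im_mul, Int.even_add, Int.even_mul, Int.even_mul] at hm
  rw [← Int.not_even_iff_odd] at hre
  tauto

theorem exists_associated_even_im {π : GaussianInt} (ho : Odd π.norm) :
    ∃ π', Associated π' π ∧ Even π'.im := by
  by_cases h : Even π.im
  · exact ⟨π, Associated.refl _, h⟩
  · refine ⟨gaussI * π, ?_, ?_⟩
    · exact associated_unit_mul_left _ _
        (IsUnit.of_mul_eq_one (-gaussI) (by rw [mul_neg, gaussI_mul_self, neg_neg]))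
    · by_contra h1
      have h2 : Odd π.re := by simpa [gaussI] using h1
      rw [Int.not_even_iff_odd] at h
      rw [norm_eq, ← Int.not_even_iff_odd] at ho
      exact ho (h2.pow.add_odd h.pow)

theorem reciprocity_intPrime {q : ℕ} (hq : q.Prime) (hqo : Odd (q : ℤ)) {s : ℤ}
    (hs : s = 1 ∨ s = -1) (hsq : (s * q) % 4 = 1) {γ : GaussianInt} (ho : Odd γ.norm)
    (hc : IsCoprime γ q) (him : Even γ.im) :
    quarticJacobiSymbol ((s * q : ℤ) : GaussianInt) γ = quarticJacobiSymbol γ q := by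
  have hqo' := odd_norm_intCast hqo
  push_cast at hqo'
  -- The induction on prime factors works up to units, while reciprocity needs even imaginary parts.
  -- Quantifying over associates allows each prime factor to be normalized and its unit moved into
  -- the cofactor.
  suffices h : ∀ γ', Associated γ' γ → IsCoprime γ' q → Even γ'.im →
      quarticJacobiSymbol ((s * q : ℤ) : GaussianInt) γ' = quarticJacobiSymbol γ' q from
    h γ (Associated.refl _) hc him
  clear hc him
  induction γ, ho using odd_induction with
  | unit u h hu =>
    intro γ ha hc him
    have hγ := ha.symm.isUnit hu
    rw [jacobi_isUnit hγ]
    rcases eq_one_or_neg_one_of_isUnit hγ him with rfl | rfl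
    · rw [jacobi_one_left hqo']
    · have := jacobi_neg_left_intCast hqo 1
      push_cast at this
      rw [this, jacobi_one_left hqo']
  | mul π β hπ hπo ho h ih =>
    intro γ ha hc him
    obtain ⟨π', hπ', hπim⟩ := exists_associated_even_im hπo
    have hπo' : Odd π'.norm := by rwa [Zsqrtd.norm_eq_of_associated (by norm_num) hπ']
    obtain ⟨u, hu⟩ := ha.symm
    obtain ⟨v, hv⟩ := hπ'
    have hγ : γ = π' * (β * (v * u : (GaussianInt)ˣ)) := by
      rw [← hu, ← hv]; push_cast; ring
    rw [hγ] at hc him ⊢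
    have hβ : Associated (β * (v * u : (GaussianInt)ˣ)) β := ⟨(v * u)⁻¹, by rw [Units.mul_inv_cancel_right]⟩
    have hβo : Odd (β * ((v * u : (GaussianInt)ˣ) : GaussianInt)).norm := by
      rwa [Zsqrtd.norm_eq_of_associated (by norm_num) hβ]
    rw [jacobi_mul_right (odd_norm_ne_zero hπo') (odd_norm_ne_zero hβo), jacobi_mul_left hqo',
      reciprocity_prime ((Associated.prime_iff ⟨v, hv⟩).2 hπ) hπo' hπim hq hqo hc.of_mul_left_left
        hs hsq,
      ih _ hβ hc.of_mul_left_right (even_im_of_mul hπo' hπim him)]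

/-- Carrying the sign s that makes sn ≡ 1 (mod 4) keeps the statement stable under n ↦ −n and under
products, since the signs of the factors multiply. -/
theorem reciprocity_sign {γ : GaussianInt} (ho : Odd γ.norm) (him : Even γ.im) {n : ℤ}
    (hn : Odd n) (hc : IsCoprime γ n) {s : ℤ} (hs : s = 1 ∨ s = -1) (hsn : (s * n) % 4 = 1) :
    quarticJacobiSymbol ((s * n : ℤ) : GaussianInt) γ = quarticJacobiSymbol γ n := by
  induction n, hn using int_odd_induction generalizing s with
  | one =>
    have hs1 : s = 1 := by rcases hs with rfl | rfl <;> omega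
    subst hs1
    simp [jacobi_one, jacobi_one_left ho]
  | neg n hn ih =>
    push_cast at hc ⊢
    rw [jacobi_neg_right (odd_norm_ne_zero (odd_norm_intCast hn)),
      ← ih (by rwa [IsCoprime.neg_right_iff] at hc) (s := -s) (by omega) (by rw [neg_mul_comm]; exact hsn)]
    push_cast
    rw [neg_mul_comm]
  | mul q n hq hqo hn ih =>
    push_cast at hc
    obtain ⟨t, ht, htq⟩ := exists_sign hqo
    have ht2 : t * t = 1 := by rcases ht with rfl | rfl <;> rfl
    have h1 : s * (q * n) = (t * q) * ((s * t) * n) := by linear_combination (-s * q * n) * ht2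
    have h2 : ((s * t) * n) % 4 = 1 := by
      rw [h1, Int.mul_emod, htq, one_mul, Int.emod_emod_of_dvd _ (dvd_refl _)] at hsn
      exact hsn
    have hst : s * t = 1 ∨ s * t = -1 := by
      rcases hs with rfl | rfl <;> rcases ht with rfl | rfl <;> simp
    have hq0 := odd_norm_ne_zero (odd_norm_intCast hqo)
    rw [h1, Int.cast_mul, jacobi_mul_left ho, Int.cast_mul (q : ℤ) n,
      jacobi_mul_right hq0 (odd_norm_ne_zero (odd_norm_intCast hn)),
      ih hc.of_mul_right_right hst h2]
    congr 1
    rw [reciprocity_intPrime hq hqo ht htq ho hc.of_mul_right_left him, Int.cast_natCast]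

/-- Quartic reciprocity between a rational integer and a Gaussian integer. -/
theorem reciprocity {γ : GaussianInt} (ho : Odd γ.norm) (him : Even γ.im) {n : ℤ}
    (hn : n % 4 = 1) (hc : IsCoprime γ n) : quarticJacobiSymbol n γ = quarticJacobiSymbol γ n := by
  have := reciprocity_sign ho him (n := n) (by rw [Int.odd_iff]; omega) hc (s := 1) (Or.inl rfl)
    (by rwa [one_mul])
  rwa [one_mul] at this

/-! ### Explicit symbols modulo primary Gaussian integers -/

theorem mk_eq (u v : ℤ) : (⟨u, v⟩ : GaussianInt) = u + v * gaussI := eq_intCast_add _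

theorem isCoprime_intCast {m n : ℤ} (h : IsCoprime m n) :
    IsCoprime (m : GaussianInt) (n : GaussianInt) := h.map (Int.castRingHom GaussianInt)

theorem isCoprime_gaussI_left (β : GaussianInt) : IsCoprime gaussI β :=
  ⟨-gaussI, 0, by rw [zero_mul, add_zero, neg_mul, gaussI_mul_self, neg_neg]⟩

/-- The quartic symbol of a rational multiple of `i` modulo a rational integer. -/
theorem jacobi_intCast_mul_gaussI {n k r : ℤ} (hn : n = 4 * k + 1)
    (hc : IsCoprime (r : GaussianInt) n) :
    quarticJacobiSymbol (r * gaussI) n = I ^ (2 * k) := by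
  have hno : Odd n := ⟨2 * k, by omega⟩
  rw [jacobi_mul_left (odd_norm_intCast hno), jacobi_intCast hno hc, one_mul,
    jacobi_gaussI (odd_norm_intCast hno) (e := 4 * k ^ 2 + 2 * k)
      (by rw [Zsqrtd.norm_intCast, hn]; ring)]
  exact I_zpow_congr (by rw [Int.modEq_iff_dvd]; exact ⟨-k ^ 2, by ring⟩)

theorem jacobi_gaussI_intCast {n k : ℤ} (hn : n = 4 * k + 1) :
    quarticJacobiSymbol gaussI n = I ^ (2 * k) := by
  have := jacobi_intCast_mul_gaussI (r := 1) hn (by push_cast; exact isCoprime_one_left)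
  simpa using this

theorem jacobi_neg_one' {β : GaussianInt} (h : Odd β.norm) {e : ℤ} (he : β.norm = 4 * e + 1) :
    quarticJacobiSymbol (-1) β = I ^ (2 * e) := by
  rw [jacobi_neg_one h he, zpow_mul]
  norm_num

/-- The supplementary law for `1 + i`. -/
theorem jacobi_one_add_gaussI_primary {u v k l : ℤ} (hu : u = 4 * k + 1) (hv : v = 4 * l)
    (hc : IsCoprime u v) : quarticJacobiSymbol (1 + gaussI) ⟨u, v⟩ = I ^ (k - l) := by
  have hN : (⟨u, v⟩ : GaussianInt).norm = 4 * (4 * k ^ 2 + 2 * k + 4 * l ^ 2) + 1 := by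
    rw [norm_eq, hu, hv]; ring
  have ho : Odd (⟨u, v⟩ : GaussianInt).norm := by
    rw [hN]; exact ⟨2 * (4 * k ^ 2 + 2 * k + 4 * l ^ 2), by ring⟩
  have him : Even (⟨u, v⟩ : GaussianInt).im := ⟨2 * l, by simp only; omega⟩
  have hcG := isCoprime_intCast hc
  have huo : Odd u := ⟨2 * k, by omega⟩
  have huv : u - v = 4 * (k - l) + 1 := by rw [hu, hv]; ring
  have huvo : Odd (u - v) := ⟨2 * (k - l), by omega⟩
  have e1 : (⟨u, v⟩ : GaussianInt) = v * gaussI + (1 : GaussianInt) * (u : GaussianInt) := by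
    rw [mk_eq]; ring
  have e2 : (⟨u, v⟩ : GaussianInt) = v * (1 + gaussI) + (1 : GaussianInt) * ((u - v : ℤ) : GaussianInt) := by
    rw [mk_eq]; push_cast; ring
  have c1 : IsCoprime (⟨u, v⟩ : GaussianInt) u := by
    rw [e1, IsCoprime.add_mul_right_left_iff]
    exact hcG.symm.mul_left (isCoprime_gaussI_left _)
  have c2' : IsCoprime (v : GaussianInt) ((u - v : ℤ) : GaussianInt) := by
    apply isCoprime_intCast
    obtain ⟨m, n, h⟩ := hc
    exact ⟨m + n, m, by linear_combination h⟩
  have c2 : IsCoprime (⟨u, v⟩ : GaussianInt) ((u - v : ℤ) : GaussianInt) := by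
    rw [e2, IsCoprime.add_mul_right_left_iff]
    exact c2'.mul_left (isCoprime_one_add_gaussI (odd_norm_intCast huvo))
  have j1 : quarticJacobiSymbol u ⟨u, v⟩ = I ^ (2 * k) := by
    rw [reciprocity ho him (by omega) c1, ← jacobi_intCast_mul_gaussI hu hcG.symm]
    exact jacobi_congr (odd_norm_intCast huo) ⟨1, by rw [e1]; ring⟩
  have j2 : quarticJacobiSymbol ((u - v : ℤ) : GaussianInt) ⟨u, v⟩ = I ^ (k - l) := by
    rw [reciprocity ho him (by omega) c2,
      jacobi_congr (odd_norm_intCast huvo) (α' := v * (1 + gaussI)) ⟨1, by rw [e2]; ring⟩,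
      jacobi_mul_left (odd_norm_intCast huvo), jacobi_intCast huvo c2', one_mul,
      jacobi_one_add_gaussI huv]
  have j3 : quarticJacobiSymbol gaussI ⟨u, v⟩ = I ^ (2 * k) := by
    rw [jacobi_gaussI ho hN]
    exact I_zpow_congr (by rw [Int.modEq_iff_dvd]; exact ⟨-k ^ 2 - l ^ 2, by ring⟩)
  have j4 : quarticJacobiSymbol (-1) ⟨u, v⟩ = 1 := by
    rw [jacobi_neg_one' ho hN, ← zpow_zero I]
    exact I_zpow_congr (by rw [Int.modEq_iff_dvd]; exact ⟨-(2 * k ^ 2 + k + 2 * l ^ 2), by ring⟩)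
  have j5 : quarticJacobiSymbol v ⟨u, v⟩ = 1 := by
    rw [jacobi_congr ho (α' := gaussI * u) ⟨-gaussI, by
      rw [mk_eq]; linear_combination (v : GaussianInt) * gaussI_sq⟩, jacobi_mul_left ho, j1, j3,
      ← zpow_add₀ Complex.I_ne_zero, ← two_mul, ← mul_assoc]
    exact I_zpow_four_mul k
  -- Since (v/·) = 1, the number 1 + i may be replaced by v(1+i) ≡ −(u − v) modulo u + vi, a
  -- rational integer to which reciprocity applies.
  calc quarticJacobiSymbol (1 + gaussI) ⟨u, v⟩
      = quarticJacobiSymbol (v * (1 + gaussI)) ⟨u, v⟩ := by rw [jacobi_mul_left ho, j5, one_mul]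
    _ = quarticJacobiSymbol (-1 * ((u - v : ℤ) : GaussianInt)) ⟨u, v⟩ :=
        jacobi_congr ho ⟨1, by rw [mk_eq]; push_cast; ring⟩
    _ = I ^ (k - l) := by rw [jacobi_mul_left ho, j4, j2, one_mul]

theorem two_eq : (2 : GaussianInt) = -1 * gaussI * (1 + gaussI) * (1 + gaussI) := by decide

theorem jacobi_two {u v k l : ℤ} (hu : u = 4 * k + 1) (hv : v = 4 * l)
    (hc : IsCoprime u v) : quarticJacobiSymbol 2 ⟨u, v⟩ = I ^ (2 * l) := by
  have hN : (⟨u, v⟩ : GaussianInt).norm = 4 * (4 * k ^ 2 + 2 * k + 4 * l ^ 2) + 1 := by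
    rw [norm_eq, hu, hv]; ring
  have ho : Odd (⟨u, v⟩ : GaussianInt).norm := by
    rw [hN]; exact ⟨2 * (4 * k ^ 2 + 2 * k + 4 * l ^ 2), by ring⟩
  rw [two_eq, jacobi_mul_left ho, jacobi_mul_left ho, jacobi_mul_left ho, jacobi_neg_one' ho hN,
    jacobi_gaussI ho hN, jacobi_one_add_gaussI_primary hu hv hc, ← zpow_add₀ Complex.I_ne_zero,
    ← zpow_add₀ Complex.I_ne_zero, ← zpow_add₀ Complex.I_ne_zero]
  exact I_zpow_congr (by rw [Int.modEq_iff_dvd]; exact ⟨-(3 * k ^ 2 + 2 * k + 3 * l ^ 2) + l, by ring⟩)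

theorem jacobi_two_sq {γ : GaussianInt} (ho : Odd γ.norm) :
    quarticJacobiSymbol 2 γ ^ 2 = quarticJacobiSymbol (-1) γ := by
  have h1 := jacobi_pow_four ho (isCoprime_one_add_gaussI ho)
  have h2 : quarticJacobiSymbol (-1) γ ^ 2 = 1 := by
    rw [sq, ← jacobi_mul_left ho, neg_one_mul, neg_neg, jacobi_one_left ho]
  have h3 : quarticJacobiSymbol gaussI γ ^ 2 = quarticJacobiSymbol (-1) γ := by
    rw [sq, ← jacobi_mul_left ho, gaussI_mul_self]
  rw [two_eq, jacobi_mul_left ho, jacobi_mul_left ho, jacobi_mul_left ho]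
  calc _ = quarticJacobiSymbol (-1) γ ^ 2 * quarticJacobiSymbol gaussI γ ^ 2 *
        quarticJacobiSymbol (1 + gaussI) γ ^ 4 := by ring
    _ = _ := by rw [h1, h2, h3]; ring

/-- Modulo b + ai one has a ≡ ib. The symbol of i comes from the norm; that of b comes from
reciprocity after choosing the sign s with sb ≡ 1 (mod 4), since b + ai ≡ ai modulo b. -/
theorem jacobi_im {a b : ℤ} (ha : Even a) (hab : IsCoprime a b) :
    (4 ∣ a → quarticJacobiSymbol a ⟨b, a⟩ = 1) ∧
      (4 ∣ a - 2 → quarticJacobiSymbol a ⟨b, a⟩ = I * (-1) ^ ((b - 1) / 2)) := by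
  have hbo : Odd b := by
    by_contra h
    rw [Int.not_odd_iff_even] at h
    have := hab.isUnit_of_dvd' ha.two_dvd h.two_dvd
    norm_num [Int.isUnit_iff] at this
  obtain ⟨s, hs, hsb⟩ := exists_sign hbo
  obtain ⟨k, hk⟩ : ∃ k, s * b = 4 * k + 1 := ⟨s * b / 4, by omega⟩
  have hs2 : s * s = 1 := by rcases hs with rfl | rfl <;> rfl
  have hb : b = s * (s * b) := by linear_combination -b * hs2
  obtain ⟨a', ha'⟩ := ha
  have hN : (⟨b, a⟩ : GaussianInt).norm = 4 * (4 * k ^ 2 + 2 * k + a' ^ 2) + 1 := by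
    rw [norm_eq, ha']; simp only
    linear_combination (-b ^ 2) * hs2 + (s * b + 4 * k + 1) * hk
  have ho : Odd (⟨b, a⟩ : GaussianInt).norm := by
    rw [hN]; exact ⟨2 * (4 * k ^ 2 + 2 * k + a' ^ 2), by ring⟩
  have him : Even (⟨b, a⟩ : GaussianInt).im := ⟨a', ha'⟩
  have hsbo : Odd (s * b) := ⟨2 * k, by omega⟩
  have hcs : IsCoprime a (s * b) := by
    refine IsCoprime.mul_right ?_ hab
    rcases hs with rfl | rfl
    · exact isCoprime_one_right
    · exact isCoprime_one_right.neg_right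
  have e1 : (⟨b, a⟩ : GaussianInt) = a * gaussI + (s : GaussianInt) * ((s * b : ℤ) : GaussianInt) := by
    rw [← Int.cast_mul, ← hb, mk_eq]; ring
  have c1 : IsCoprime (⟨b, a⟩ : GaussianInt) ((s * b : ℤ) : GaussianInt) := by
    rw [e1, IsCoprime.add_mul_right_left_iff]
    exact (isCoprime_intCast hcs).mul_left (isCoprime_gaussI_left _)
  have j1 : quarticJacobiSymbol ((s * b : ℤ) : GaussianInt) ⟨b, a⟩ = I ^ (2 * k) := by
    rw [reciprocity ho him hsb c1, ← jacobi_intCast_mul_gaussI hk (isCoprime_intCast hcs)]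
    exact jacobi_congr (odd_norm_intCast hsbo) ⟨s, by rw [e1]; ring⟩
  have j2 : quarticJacobiSymbol a ⟨b, a⟩ =
      I ^ (4 * k ^ 2 + 2 * k + a' ^ 2) * (quarticJacobiSymbol (s : GaussianInt) ⟨b, a⟩ * I ^ (2 * k)) := by
    rw [← j1, ← jacobi_mul_left ho, ← jacobi_gaussI ho hN, ← jacobi_mul_left ho, ← Int.cast_mul, ← hb]
    exact jacobi_congr ho ⟨-gaussI, by
      rw [mk_eq]; linear_combination (a : GaussianInt) * gaussI_sq⟩
  have j3 : quarticJacobiSymbol (-1) ⟨b, a⟩ = I ^ (2 * (4 * k ^ 2 + 2 * k + a' ^ 2)) :=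
    jacobi_neg_one' ho hN
  have hneg : ∀ n : ℤ, ((-1 : ℂ)) ^ n = I ^ (2 * n) := fun n => by rw [zpow_mul]; norm_num
  constructor
  · rintro ⟨m, hm⟩
    have hm' : a' = 2 * m := by omega
    rw [j2, ← zpow_zero I]
    rcases hs with rfl | rfl
    · rw [Int.cast_one, jacobi_one_left ho, one_mul, ← zpow_add₀ Complex.I_ne_zero]
      exact I_zpow_congr (by
        rw [Int.modEq_iff_dvd, hm']; exact ⟨-(k ^ 2 + k + m ^ 2), by ring⟩)
    · rw [Int.cast_neg, Int.cast_one, j3, ← zpow_add₀ Complex.I_ne_zero,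
        ← zpow_add₀ Complex.I_ne_zero]
      exact I_zpow_congr (by
        rw [Int.modEq_iff_dvd, hm']; exact ⟨-(3 * k ^ 2 + 2 * k + 3 * m ^ 2), by ring⟩)
  · rintro ⟨m, hm⟩
    have hm' : a' = 2 * m + 1 := by omega
    rw [j2, hneg, ← zpow_one_add₀ Complex.I_ne_zero]
    rcases hs with rfl | rfl
    · rw [Int.cast_one, jacobi_one_left ho, one_mul, ← zpow_add₀ Complex.I_ne_zero]
      rw [show (b - 1) / 2 = 2 * k by omega]
      exact I_zpow_congr (by
        rw [Int.modEq_iff_dvd, hm']; exact ⟨-(k ^ 2 + m ^ 2 + m), by ring⟩)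
    · rw [Int.cast_neg, Int.cast_one, j3, ← zpow_add₀ Complex.I_ne_zero,
        ← zpow_add₀ Complex.I_ne_zero, show (b - 1) / 2 = -2 * k - 1 by omega]
      exact I_zpow_congr (by
        rw [Int.modEq_iff_dvd, hm']; exact ⟨-(3 * k ^ 2 + 3 * k + 3 * m ^ 2 + 3 * m + 1), by ring⟩)

/-! ### From symbols modulo b + ai to symbols modulo c − di -/

/-- A quadratic polynomial whose coefficients have no common prime factor dividing `M`
takes a value coprime to `M`. -/
theorem exists_isCoprime_quadratic {A B C : ℤ} (hA : Odd A) {M : ℤ}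
    (hM : M ≠ 0) (h : ∀ l : ℕ, l.Prime → (l : ℤ) ∣ M → (l : ℤ) ∣ A → (l : ℤ) ∣ B → (l : ℤ) ∣ C →
      False) : ∃ t, IsCoprime (A + B * t + C * t ^ 2) M := by
  have key : ∀ m : ℕ, m ≠ 0 → (m : ℤ) ∣ M → ∃ t, IsCoprime (A + B * t + C * t ^ 2) (m : ℤ) := by
    intro m
    induction m using induction_on_primes with
    | zero => intro h; exact absurd rfl h
    | one => exact fun _ _ => ⟨0, by push_cast; exact isCoprime_one_right⟩
    | prime_mul l m hl ih =>
      intro h0 hd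
      push_cast at hd ⊢
      obtain ⟨t, ht⟩ := ih (right_ne_zero_of_mul h0) (dvd_of_mul_left_dvd hd)
      have hlp : Prime (l : ℤ) := Nat.prime_iff_prime_int.1 hl
      have hcop : ∀ z : ℤ, ¬ (l : ℤ) ∣ z → IsCoprime z l := fun z hz =>
        (hlp.irreducible.coprime_iff_not_dvd.2 hz).symm
      by_cases hlm : l ∣ m
      · refine ⟨t, IsCoprime.mul_right ?_ ht⟩
        exact ht.of_isCoprime_of_dvd_right (by exact_mod_cast hlm)
      -- Were all values divisible by l, those at 0, 1 and −1 would force l to divide A, 2B and 2C;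
      -- l = 2 is impossible because A is odd.
      · have hlt : ∃ w, ¬ (l : ℤ) ∣ A + B * w + C * w ^ 2 := by
          by_contra! hall
          have a0 : (l : ℤ) ∣ A := by simpa using hall 0
          have a1 := hall 1
          have a2 := hall (-1)
          have hl2 : ¬ (l : ℤ) ∣ 2 := by
            intro h2
            have h3 : l = 2 := (Nat.prime_dvd_prime_iff_eq hl Nat.prime_two).1 (by exact_mod_cast h2)
            subst h3
            exact (Int.not_even_iff_odd.2 hA) (even_iff_two_dvd.2 a0)
          have b1 : (l : ℤ) ∣ 2 * B := by
            have := dvd_sub a1 a2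
            ring_nf at this ⊢
            exact this
          have b2 : (l : ℤ) ∣ 2 * C := by
            have := dvd_sub (dvd_add a1 a2) (a0.mul_left 2)
            ring_nf at this ⊢
            exact this
          exact h l hl (dvd_of_mul_right_dvd hd) a0 ((hlp.dvd_or_dvd b1).resolve_left hl2)
            ((hlp.dvd_or_dvd b2).resolve_left hl2)
        obtain ⟨w, hw⟩ := hlt
        obtain ⟨α, β, hαβ⟩ := hcop m (by exact_mod_cast hlm)
        -- Chinese remainder: T ≡ w modulo l and T ≡ t modulo m.
        obtain ⟨T, hT⟩ : ∃ T, T = t * (β * l) + w * (α * m) := ⟨_, rfl⟩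
        refine ⟨T, IsCoprime.mul_right ?_ ?_⟩
        · have e : A + B * T + C * T ^ 2 =
              A + B * w + C * w ^ 2 + l * ((t - w) * β * (B + C * (T + w))) := by
            linear_combination (B + C * (T + w)) * hT + w * (B + C * (T + w)) * hαβ
          rw [e]
          exact (hcop _ hw).add_mul_left_left _
        · have e : A + B * T + C * T ^ 2 =
              A + B * t + C * t ^ 2 + m * ((w - t) * α * (B + C * (T + t))) := by
            linear_combination (B + C * (T + t)) * hT + t * (B + C * (T + t)) * hαβ
          rw [e]
          exact ht.add_mul_left_left _
  obtain ⟨t, ht⟩ := key M.natAbs (Int.natAbs_ne_zero.2 hM) (Int.natAbs_dvd.2 dvd_rfl)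
  exact ⟨t, ht.of_isCoprime_of_dvd_right (Int.dvd_natAbs.2 dvd_rfl)⟩

local notation "Jac" => quarticJacobiSymbol

theorem odd_of_eq {n k : ℤ} (h : n = 4 * k + 1) : Odd n := ⟨2 * k, by omega⟩

theorem I_zpow_two_mul_sq (n : ℤ) : (I ^ n) ^ 2 = I ^ (2 * n) := by
  rw [← zpow_natCast, ← zpow_mul, mul_comm]; rfl

theorem isCoprime_of_eq_add {R : Type*} [CommRing R] {n a b z : R} (h : IsCoprime n b)
    (e : a = b + n * z) : IsCoprime n a := by
  rw [e]; exact h.add_mul_left_right z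

/-- For `γ = s x + s̄ π = (1 + i) γ₁` with `s = 1 + v i` and `π = d + c i`, the quartic symbol of
`Q` modulo `γ₁` is expressed through symbols modulo `π`. -/
theorem auxiliary_identity {c d x y Q v h g₁ g₂ p t X C D Y q V : ℤ}
    (hcd : p = c ^ 2 + d ^ 2) (hxy : p = x ^ 2 + 2 * Q * y ^ 2)
    (hx : x = 4 * X + 1) (hc : c = 4 * C + 1) (hd : d = 4 * D) (hy : y = 2 * Y)
    (hQ : Q = 4 * q + 1) (hvx : v = x * t) (hv : v = 8 * V)
    (hh : h = x + d + 2 * v * c + v ^ 2 * (x - d))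
    (hg₁ : 2 * g₁ = (x + d + v * c) + (c + v * x - v * d))
    (hg₂ : 2 * g₂ = (c + v * x - v * d) - (x + d + v * c))
    (hy0 : y ≠ 0) (hxQ : IsCoprime x Q) (hxy' : IsCoprime x y) (hyp : IsCoprime y p)
    (hhQ : IsCoprime h Q) (hhy : IsCoprime h y) (hhp : IsCoprime h p) (hcd' : IsCoprime c d)
    (hxp : IsCoprime x p) :
    Odd (⟨g₁, g₂⟩ : GaussianInt).norm ∧ Even g₂ ∧ IsCoprime (Q : GaussianInt) ⟨g₁, g₂⟩ ∧
    Jac Q ⟨g₁, g₂⟩ * Jac y ⟨c, -d⟩ = I ^ (3 * D + 2 * X) * Jac x ⟨c, -d⟩ := by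
  have hI0 := Complex.I_ne_zero
  obtain ⟨S, hS⟩ : ∃ S, S = 1 + v ^ 2 := ⟨_, rfl⟩
  obtain ⟨γ₁, hγ₁⟩ : ∃ γ₁ : GaussianInt, γ₁ = ⟨g₁, g₂⟩ := ⟨_, rfl⟩
  obtain ⟨s, hs⟩ : ∃ s : GaussianInt, s = ⟨1, v⟩ := ⟨_, rfl⟩
  obtain ⟨π, hπ⟩ : ∃ π : GaussianInt, π = ⟨d, c⟩ := ⟨_, rfl⟩
  obtain ⟨ϖ, hϖ⟩ : ∃ ϖ : GaussianInt, ϖ = ⟨c, -d⟩ := ⟨_, rfl⟩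
  obtain ⟨γ, hγ⟩ : ∃ γ : GaussianInt, γ = ⟨x + d + v * c, c + v * x - v * d⟩ := ⟨_, rfl⟩
  obtain ⟨H, hH⟩ : ∃ H, H = X + D + 4 * V * c + 16 * V ^ 2 * (x - d) := ⟨_, rfl⟩
  have hH4 : h = 4 * H + 1 := by
    rw [hh, hH, hv, hx, hd]; ring
  have hSV : S = 4 * (16 * V ^ 2) + 1 := by rw [hS, hv]; ring
  -- relations between the elements
  have rγ : γ = (1 + gaussI) * γ₁ := by
    rw [hγ, hγ₁]
    ext
    · simp; linarith
    · simp; linarith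
  have rγs : γ = s * x + star s * π := by
    rw [hγ, hs, hπ]; ext <;> simp <;> ring
  have rγs' : star γ = star s * x + s * star π := by
    rw [rγs, star_add, star_mul', star_mul', star_star, star_intCast]
  have rπ : π = gaussI * ϖ := by
    rw [hπ, hϖ]; ext <;> simp
  have rππ : π * star π = (p : GaussianInt) := by
    rw [hπ, hcd]; ext
    · simp [pow_two]; ring
    · simp [pow_two]; ring
  have rss : s * star s = (S : GaussianInt) := by
    rw [hs, hS]; ext
    · simp [pow_two]
    · simp [pow_two]
  have rs2 : s + star s = 2 := by
    rw [hs]; ext <;> simp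
  have rsv : s = 1 + (v : GaussianInt) * gaussI := by rw [hs, mk_eq]; push_cast; ring
  -- Here N(γ) = 2N(γ₁), and the two representations of p replace c² + d² by x² + 2Qy².
  have hN : g₁ ^ 2 + g₂ ^ 2 = x * h + S * Q * y ^ 2 := by
    have h4 : 4 * (g₁ ^ 2 + g₂ ^ 2) = 4 * (x * h + S * Q * y ^ 2) := by
      rw [hh, hS]
      linear_combination (2 * g₁ + (x + d + v * c) + (c + v * x - v * d)) * hg₁ +
        (2 * g₂ + (c + v * x - v * d) - (x + d + v * c)) * hg₂ +
        2 * (1 + v ^ 2) * (hxy - hcd)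
    linarith
  have rN : γ₁ * star γ₁ = ((x * h + S * Q * y ^ 2 : ℤ) : GaussianInt) := by
    rw [← hN, ← Zsqrtd.norm_eq_mul_conj, norm_eq, hγ₁]
  have rh : (h : GaussianInt) = 2 * π + s * (star s * ((x - d : ℤ) : GaussianInt) - 2 * c * gaussI) := by
    rw [hh, hs, hπ]; ext
    · simp [pow_two]; ring
    · simp [pow_two]; ring
  have rr : ∃ r : ℤ, star s * γ = r * gaussI + h * 1 := by
    refine ⟨c + v * x - v * d - v * (x + d + v * c), ?_⟩
    rw [hs, hγ, hh]; ext
    · simp [pow_two]; ring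
    · simp [pow_two]; ring
  obtain ⟨r, rr⟩ := rr
  -- parities
  obtain ⟨m, hm⟩ : ∃ m, Y * (Y - 1) = 2 * m := (Int.even_mul_pred_self Y).two_dvd
  obtain ⟨e, he⟩ : ∃ e, e = 4 * X * H + X + H + S * Q * Y ^ 2 := ⟨_, rfl⟩
  have hNe : γ₁.norm = 4 * e + 1 := by
    rw [norm_eq, hγ₁]; simp only
    rw [hN, he, hH4, hx, hy]; ring
  have ho : Odd γ₁.norm := odd_of_eq hNe
  have him₂ : Even g₂ := by
    refine ⟨C - X - D + 2 * V * (x - d - c), ?_⟩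
    rw [hv, hx, hc, hd] at *
    linarith
  have him : Even γ₁.im := by rw [hγ₁]; exact him₂
  have hsN : s.norm = S := by rw [norm_eq, hs, hS]; ring
  have hso : Odd s.norm := by rw [hsN]; exact odd_of_eq hSV
  have hsim : Even s.im := by rw [hs]; exact ⟨4 * V, by simp only; omega⟩
  have hϖN : ϖ.norm = p := by rw [norm_eq, hϖ, hcd]; ring
  have hpe : p = 4 * (4 * C ^ 2 + 2 * C + 4 * D ^ 2) + 1 := by rw [hcd, hc, hd]; ring
  have hϖo : Odd ϖ.norm := by rw [hϖN]; exact odd_of_eq hpe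
  have hϖim : Even ϖ.im := by rw [hϖ]; exact ⟨-(2 * D), by simp only; omega⟩
  have hxo := odd_norm_intCast (odd_of_eq hx)
  have hho := odd_norm_intCast (odd_of_eq hH4)
  -- coprimality
  have cSx : IsCoprime x S := ⟨-(x * t ^ 2), 1, by rw [hS, hvx]; ring⟩
  -- Modulo s one has h ≡ 2π, so a common divisor of s and π would divide both h and p = ππ̄.
  have csπ : IsCoprime s π := by
    obtain ⟨α, β, hαβ⟩ := isCoprime_intCast hhp
    rw [rh, ← rππ] at hαβ
    exact ⟨α * (star s * ((x - d : ℤ) : GaussianInt) - 2 * c * gaussI), 2 * α + β * star π,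
      by linear_combination hαβ⟩
  have cs2 : IsCoprime (2 : GaussianInt) s := isCoprime_two hso
  have csh : IsCoprime s h := by
    rw [rh]
    exact (cs2.symm.mul_right csπ).add_mul_left_right _
  have cssh : IsCoprime (star s) h := by
    have := csh.map (starRingEnd GaussianInt)
    rwa [starRingEnd_apply, starRingEnd_apply, star_intCast] at this
  have chS : IsCoprime (h : GaussianInt) S := by
    rw [← rss]; exact csh.symm.mul_right cssh.symm
  have toγ : ∀ {n : GaussianInt}, IsCoprime n ((x * h + S * Q * y ^ 2 : ℤ) : GaussianInt) →
      IsCoprime n γ₁ := fun hn => by rw [← rN] at hn; exact hn.of_mul_right_left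
  have chγ : IsCoprime (h : GaussianInt) γ₁ := by
    apply toγ
    push_cast
    have := (chS.mul_right (isCoprime_intCast hhQ)).mul_right ((isCoprime_intCast hhy).pow_right (n := 2))
    exact isCoprime_of_eq_add this (z := (x : GaussianInt)) (by ring)
  have cxγ : IsCoprime (x : GaussianInt) γ₁ := by
    apply toγ
    apply isCoprime_intCast
    have := (cSx.mul_right hxQ).mul_right (hxy'.pow_right (n := 2))
    exact isCoprime_of_eq_add this (z := h) (by ring)
  have cSγ : IsCoprime (S : GaussianInt) γ₁ := by
    apply toγ
    push_cast
    have := (isCoprime_intCast cSx.symm).mul_right chS.symm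
    exact isCoprime_of_eq_add this (z := ((Q : GaussianInt) * y ^ 2)) (by ring)
  have cQγ : IsCoprime (Q : GaussianInt) γ₁ := by
    apply toγ
    apply isCoprime_intCast
    have := hxQ.symm.mul_right hhQ.symm
    exact isCoprime_of_eq_add this (z := (S * y ^ 2)) (by ring)
  have cyγ : IsCoprime (y : GaussianInt) γ₁ := by
    apply toγ
    apply isCoprime_intCast
    have := hxy'.symm.mul_right hhy.symm
    exact isCoprime_of_eq_add this (z := (S * Q * y)) (by ring)
  have dϖp : ϖ ∣ (p : GaussianInt) := by
    rw [← hϖN, Zsqrtd.norm_eq_mul_conj]; exact dvd_mul_right _ _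
  have cyϖ : IsCoprime (y : GaussianInt) ϖ :=
    (isCoprime_intCast hyp).of_isCoprime_of_dvd_right dϖp
  have cxϖ : IsCoprime (x : GaussianInt) ϖ :=
    (isCoprime_intCast hxp).of_isCoprime_of_dvd_right dϖp
  -- symbols of `x`, `h`, `S` modulo `γ₁`
  have Jπn : ∀ {n N : ℤ}, n = 4 * N + 1 → IsCoprime (n : GaussianInt) ϖ →
      Jac π n = I ^ (2 * N) * Jac n ϖ := fun {n N} hn hcop => by
    rw [rπ, jacobi_mul_left (odd_norm_intCast (odd_of_eq hn)), jacobi_gaussI_intCast hn,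
      reciprocity hϖo hϖim (by omega) hcop.symm]
  have Jγn : ∀ {n N : ℤ}, n = 4 * N + 1 → IsCoprime (n : GaussianInt) γ₁ →
      Jac γ n = I ^ N * Jac n γ₁ := fun {n N} hn hcop => by
    rw [rγ, jacobi_mul_left (odd_norm_intCast (odd_of_eq hn)), jacobi_one_add_gaussI hn,
      reciprocity ho him (by omega) hcop.symm]
  -- Because x divides v, both s and s̄ are 1 modulo x, hence γ ≡ π modulo x.
  have Jx : Jac x γ₁ = I ^ X * Jac x ϖ := by
    have h1 := Jγn hx cxγ
    rw [jacobi_congr hxo (α' := π) ⟨s - t * gaussI * π, by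
      rw [rγs, show star s = 2 - s by rw [← rs2]; ring, rsv, hvx]; push_cast; ring⟩,
      Jπn hx cxϖ, two_mul, zpow_add₀ hI0, mul_assoc] at h1
    exact (mul_left_cancel₀ (zpow_ne_zero _ hI0) h1).symm
  have Jxs : Jac x s = 1 := by
    have csx : IsCoprime s x := by
      have := (isCoprime_intCast cSx).symm
      rw [← rss] at this
      exact this.of_mul_left_left
    rw [reciprocity hso hsim (by omega) csx, jacobi_congr hxo (α' := 1) ⟨t * gaussI, by
      rw [rsv, hvx]; push_cast; ring⟩, jacobi_one_left hxo]
  have J2s : Jac 2 s = 1 := by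
    rw [hs, jacobi_two (k := 0) (l := 2 * V) (by norm_num) (by omega) isCoprime_one_left,
      show 2 * (2 * V) = 4 * V by ring, I_zpow_four_mul]
  have Jsh : Jac s h = Jac π s := by
    rw [← reciprocity hso hsim (by omega) csh, jacobi_congr hso (α' := 2 * π) ⟨_, by
      rw [rh, add_sub_cancel_left]⟩, jacobi_mul_left hso, J2s, one_mul]
  have Jπs := jacobi_mul_star hso csπ.symm
  -- h is the real part of s̄γ, so s̄γ is a rational multiple of i modulo h and its symbol is known.
  -- The factor (s̄/h) is the conjugate of (s/h) = (h/s) = (2π/s) = (π/s).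
  have Jh : Jac h γ₁ = I ^ H * Jac π s := by
    have chr : IsCoprime (r : GaussianInt) h := by
      have c1 : IsCoprime (star s * γ) h := by
        rw [rγ]
        exact cssh.mul_left ((isCoprime_one_add_gaussI hho).mul_left chγ.symm)
      rw [rr, IsCoprime.add_mul_left_left_iff] at c1
      exact c1.of_mul_left_left
    have h1 : Jac (star s * γ) h = I ^ (2 * H) := by
      rw [jacobi_congr hho (α' := r * gaussI) ⟨1, by rw [rr]; ring⟩, jacobi_intCast_mul_gaussI hH4 chr]
    have h2 : Jac (star s) h = star (Jac π s) := by
      rw [← Jsh, ← jacobi_star hho, star_intCast]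
    rw [jacobi_mul_left hho, h2, Jγn hH4 chγ, two_mul, zpow_add₀ hI0] at h1
    apply mul_left_cancel₀ (zpow_ne_zero H hI0)
    linear_combination (Jac π s) * h1 - (I ^ H * Jac h γ₁) * Jπs
  -- Split S = ss̄. Modulo s one has γ ≡ s̄π, and modulo s̄ one has γ ≡ sx; the contributions (s̄/s)
  -- and (s/s̄) are conjugate and cancel, leaving (π/s).
  have JS : Jac S γ₁ = Jac π s := by
    have h1 := Jγn hSV cSγ
    have css : IsCoprime (star s) s := by
      have : star s = 2 + s * (-1) := by rw [← rs2]; ring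
      rw [this]
      exact cs2.add_mul_left_left _
    have h2 : Jac γ s = Jac (star s) s * Jac π s := by
      rw [← jacobi_mul_left hso]
      exact jacobi_congr hso ⟨x, by rw [rγs]; ring⟩
    have h3 : Jac γ (star s) = star (Jac (star s) s) := by
      rw [← star_star γ, jacobi_star hso, jacobi_congr hso (α' := star s * x) ⟨star π, by
        rw [rγs']; ring⟩, jacobi_mul_left hso, Jxs, mul_one]
    have h4 := jacobi_mul_star hso css
    rw [← rss, jacobi_mul_right (odd_norm_ne_zero hso) (by simpa using odd_norm_ne_zero hso), h2, h3,
      rss, show 16 * V ^ 2 = 4 * (4 * V ^ 2) by ring, I_zpow_four_mul, one_mul] at h1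
    rw [← h1]
    linear_combination (Jac π s) * h4
  -- the symbol of `y`
  have J1 : Jac (-1) γ₁ = I ^ (2 * (D + Y)) := by
    rw [jacobi_neg_one' ho hNe]
    apply I_zpow_congr
    rw [Int.modEq_iff_dvd]
    refine ⟨-(2 * X * H + X + 2 * V * c + 8 * V ^ 2 * (x - d) +
      (q + 16 * V ^ 2 * q * 4 + 16 * V ^ 2) * 2 * Y ^ 2 + m), ?_⟩
    rw [he, hH, hSV, hQ]
    linear_combination (-2) * hm
  have J1ϖ : Jac (-1) ϖ = 1 := by
    rw [jacobi_neg_one' hϖo (e := 4 * C ^ 2 + 2 * C + 4 * D ^ 2) (by rw [hϖN, hpe]), ← zpow_zero I]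
    apply I_zpow_congr
    rw [Int.modEq_iff_dvd]
    exact ⟨-(2 * C ^ 2 + C + 2 * D ^ 2), by ring⟩
  have J1sq : Jac (-1) γ₁ ^ 2 = 1 := by
    rw [sq, ← jacobi_mul_left ho, neg_one_mul, neg_neg, jacobi_one_left ho]
  have J2 : Jac 2 γ₁ ^ 2 = I ^ (2 * Y) * Jac 2 ϖ := by
    rw [jacobi_two_sq ho, J1, hϖ, jacobi_two hc (l := -D) (by omega) hcd'.neg_right,
      ← zpow_add₀ hI0]
    apply I_zpow_congr
    rw [Int.modEq_iff_dvd]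
    exact ⟨-D, by ring⟩
  -- Modulo n ∣ y one has γπ̄ ≡ xγ̄, so γ²π̄ ≡ xγγ̄ is rational and has symbol 1. As ππ̄ = p also
  -- has symbol 1, (γ/n)² = (π/n).
  have Jodd : ∀ {n N : ℤ}, n = 4 * N + 1 → n ∣ y → Jac n γ₁ ^ 2 = Jac n ϖ := fun {n N} hn hny => by
    have hno := odd_norm_intCast (odd_of_eq hn)
    have dn : (n : GaussianInt) ∣ y := map_dvd (Int.castRingHom GaussianInt) hny
    have cnγ := cyγ.of_isCoprime_of_dvd_left dn
    have cnϖ := cyϖ.of_isCoprime_of_dvd_left dn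
    have cnp : IsCoprime (p : GaussianInt) n :=
      ((isCoprime_intCast hyp).of_isCoprime_of_dvd_left dn).symm
    have h1 : Jac (p : GaussianInt) n = 1 := jacobi_intCast (odd_of_eq hn) cnp
    have cπb : IsCoprime (star π) n := by rw [← rππ] at cnp; exact cnp.of_mul_left_right
    have h2 : Jac γ n ^ 2 * Jac (star π) n = 1 := by
      have c1 : IsCoprime ((x * (x * h + S * Q * y ^ 2) * 2 : ℤ) : GaussianInt) n := by
        apply isCoprime_intCast
        have cny : IsCoprime n x := (hxy'.symm).of_isCoprime_of_dvd_left hny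
        have cnh : IsCoprime n h := (hhy.symm).of_isCoprime_of_dvd_left hny
        have c2 : IsCoprime n 2 := ⟨1, -(2 * N), by rw [hn]; ring⟩
        obtain ⟨w, hw⟩ := hny
        refine (((cny.mul_right ?_).mul_right c2)).symm
        have := cny.mul_right cnh
        exact isCoprime_of_eq_add this (z := S * Q * w * y)
          (by linear_combination (S * Q * y) * hw)
      rw [sq, ← jacobi_mul_left hno, ← jacobi_mul_left hno,
        ← jacobi_intCast (odd_of_eq hn) c1]
      obtain ⟨w, hw⟩ := dn
      apply jacobi_congr hno
      refine ⟨γ * (star s * 2 * Q * w * y), ?_⟩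
      have e1 : γ * star π = x * star γ + star s * 2 * Q * y ^ 2 := by
        rw [rγs']
        have e2 : (p : GaussianInt) = x ^ 2 + 2 * Q * y ^ 2 := by rw [hxy]; push_cast; ring
        rw [rγs]
        linear_combination star s * rππ + star s * e2
      have e3 : γ * star γ = 2 * (((x * h + S * Q * y ^ 2 : ℤ) : GaussianInt)) := by
        rw [rγ, star_mul', ← rN, show star (1 + gaussI) = 1 - gaussI by decide]
        linear_combination (-γ₁ * star γ₁) * gaussI_sq
      rw [mul_assoc γ γ, e1]
      push_cast at e3 ⊢
      linear_combination (x : GaussianInt) * e3 + γ * star s * 2 * Q * y * hw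
    have h3 : Jac γ n ^ 2 = Jac π n := by
      apply mul_right_cancel₀ (jacobi_ne_zero hno cπb)
      rw [h2, ← jacobi_mul_left hno, rππ, h1]
    rw [Jγn hn cnγ, Jπn hn cnϖ, mul_pow, I_zpow_two_mul_sq] at h3
    exact mul_left_cancel₀ (zpow_ne_zero _ hI0) h3
  have Jy : Jac y γ₁ ^ 2 = I ^ (2 * Y) * Jac y ϖ := by
    obtain ⟨k, w, hwo, hkw⟩ : ∃ (k : ℕ) (w : ℤ), Odd w ∧ y = 2 ^ k * w := by
      obtain ⟨k, w, hw, hkw⟩ := Nat.exists_eq_two_pow_mul_odd (Int.natAbs_ne_zero.2 hy0)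
      have hw' : Odd (w : ℤ) := by exact_mod_cast hw
      rcases Int.natAbs_eq y with h1 | h1
      · exact ⟨k, w, hw', by rw [h1, hkw]; push_cast; rfl⟩
      · exact ⟨k, -w, hw'.neg, by rw [h1, hkw]; push_cast; ring⟩
    obtain ⟨ε, hε, hεw⟩ := exists_sign hwo
    obtain ⟨N, hN'⟩ : ∃ N, ε * w = 4 * N + 1 := ⟨ε * w / 4, by omega⟩
    have hε2 : ε * ε = 1 := by rcases hε with rfl | rfl <;> rfl
    have hyw : y = ε * (2 ^ k * (ε * w)) := by rw [hkw]; linear_combination (-(2 ^ k * w)) * hε2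
    have hεJ : Jac (ε : GaussianInt) γ₁ ^ 2 = 1 ∧ Jac (ε : GaussianInt) ϖ = 1 := by
      rcases hε with rfl | rfl
      · push_cast
        exact ⟨by rw [jacobi_one_left ho, one_pow], jacobi_one_left hϖo⟩
      · push_cast
        exact ⟨J1sq, J1ϖ⟩
    have hpow : ∀ (β : GaussianInt), Odd β.norm → Jac (2 ^ k) β = Jac 2 β ^ k := fun β hβ => by
      clear hyw hkw
      induction k with
      | zero => simp [jacobi_one_left hβ]
      | succ k ih => rw [pow_succ, jacobi_mul_left hβ, ih, pow_succ]
    have hy' : (y : GaussianInt) = ε * (2 ^ k * ((ε * w : ℤ) : GaussianInt)) := by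
      rw [hyw]; push_cast; rfl
    -- The exponent k is positive because y is even; for k ≥ 2 the number Y is even too, and both
    -- sides are 1.
    have hk2 : (I ^ (2 * Y)) ^ k = I ^ (2 * Y) := by
      rw [← zpow_natCast, ← zpow_mul]
      apply I_zpow_congr
      match k, hkw with
      | 0, hkw =>
        rw [pow_zero, one_mul] at hkw
        rw [← hkw, hy] at hwo
        exact absurd hwo (by simp)
      | 1, _ => simp
      | k + 2, hkw =>
        have : Y = 2 * (2 ^ k * w) := by
          have : 2 * Y = 2 * (2 * (2 ^ k * w)) := by rw [← hy, hkw]; ring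
          omega
        rw [Int.modEq_iff_dvd, this]
        exact ⟨(2 ^ k * w) * (1 - ((k + 2 : ℕ) : ℤ)), by ring⟩
    rw [hy', jacobi_mul_left ho, jacobi_mul_left ho, jacobi_mul_left hϖo, jacobi_mul_left hϖo,
      hpow _ ho, hpow _ hϖo, hεJ.2, mul_pow, mul_pow, hεJ.1,
      Jodd hN' ⟨ε * 2 ^ k, by rw [hkw]; linear_combination (-(2 ^ k * w)) * hε2⟩,
      ← pow_mul, mul_comm k 2, pow_mul, J2, mul_pow, hk2]
    ring
  refine ⟨hγ₁ ▸ ho, him₂, hγ₁ ▸ cQγ, ?_⟩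
  rw [← hγ₁, ← hϖ]
  -- The norm identity says SQy² ≡ −xh modulo γ₁.
  have key : Jac S γ₁ * Jac Q γ₁ * Jac y γ₁ ^ 2 = Jac (-1) γ₁ * Jac x γ₁ * Jac h γ₁ := by
    rw [sq, ← jacobi_mul_left ho, ← jacobi_mul_left ho, ← jacobi_mul_left ho, ← jacobi_mul_left ho,
      ← jacobi_mul_left ho]
    apply jacobi_congr ho
    exact ⟨star γ₁, by rw [rN]; push_cast; ring⟩
  rw [Jy, J1, Jx, JS, Jh] at key
  have hP0 : Jac π s ≠ 0 := jacobi_ne_zero hso csπ.symm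
  have hIY : I ^ (2 * Y) ≠ 0 := zpow_ne_zero _ hI0
  apply mul_left_cancel₀ (mul_ne_zero hP0 hIY)
  have hexp : I ^ (2 * Y) * I ^ (3 * D + 2 * X) = I ^ (2 * (D + Y)) * I ^ X * I ^ H := by
    rw [← zpow_add₀ hI0, ← zpow_add₀ hI0, ← zpow_add₀ hI0]
    apply I_zpow_congr
    rw [Int.modEq_iff_dvd, hH]
    exact ⟨V * c + 4 * V ^ 2 * (x - d), by ring⟩
  linear_combination key - (Jac π s * Jac x ϖ) * hexp

theorem isCoprime_of_sq_lt {p : ℕ} (hp : p.Prime) {z : ℤ} (h0 : z ≠ 0) (h : z ^ 2 < p) :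
    IsCoprime z p := by
  rw [isCoprime_comm, (Nat.prime_iff_prime_int.1 hp).irreducible.coprime_iff_not_dvd]
  intro hd
  have := Int.le_of_dvd (by positivity) (hd.trans (dvd_pow_self z two_ne_zero))
  omega

theorem natCast_prime_ne_sq {p : ℕ} (hp : p.Prime) (z : ℤ) : (p : ℤ) ≠ z ^ 2 := by
  intro h
  have h1 := Nat.prime_iff_prime_int.1 hp
  rw [h] at h1
  exact not_prime_pow (by norm_num) h1

/-- The quartic symbol of `π / x` modulo `b + a i`, where `p = π π̄ = x² + 2 (a² + b²) y²`. -/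
theorem symbol_identity {p : ℕ} (hp : p.Prime) {a b c d x y X C D Y q : ℤ}
    (hcd : (p : ℤ) = c ^ 2 + d ^ 2) (hxy : (p : ℤ) = x ^ 2 + 2 * (a ^ 2 + b ^ 2) * y ^ 2)
    (hx : x = 4 * X + 1) (hc : c = 4 * C + 1) (hd : d = 4 * D) (hy : y = 2 * Y)
    (ha0 : a ≠ 0) (hQ : a ^ 2 + b ^ 2 = 4 * q + 1) :
    IsCoprime c d ∧ y ≠ 0 ∧ IsCoprime x p ∧ IsCoprime y p ∧
      IsCoprime (x : GaussianInt) (⟨b, a⟩ : GaussianInt) ∧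
      IsCoprime (⟨d, c⟩ : GaussianInt) (⟨b, a⟩ : GaussianInt) ∧
      Jac ⟨d, c⟩ ⟨b, a⟩ * Jac y ⟨c, -d⟩ =
        Jac x ⟨b, a⟩ * I ^ (q + 3 * D + 2 * X) * Jac x ⟨c, -d⟩ := by
  have hI0 := Complex.I_ne_zero
  obtain ⟨Q, hQd⟩ : ∃ Q, Q = a ^ 2 + b ^ 2 := ⟨_, rfl⟩
  rw [← hQd] at hxy hQ
  have hQ0 : 0 < Q := by rw [hQd]; positivity
  have hy0 : y ≠ 0 := by
    rintro rfl
    exact natCast_prime_ne_sq hp x (by rw [hxy]; ring)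
  have hx0 : x ≠ 0 := by omega
  have hc0 : c ≠ 0 := by omega
  have hd0 : d ≠ 0 := by
    rintro rfl
    exact natCast_prime_ne_sq hp c (by rw [hcd]; ring)
  have hp0 : (p : ℤ) ≠ 0 := by exact_mod_cast hp.ne_zero
  have hy2 : 0 < y ^ 2 := by positivity
  have hx2 : 0 < x ^ 2 := by positivity
  have hd2 : 0 < d ^ 2 := by positivity
  have hxp : IsCoprime x p := isCoprime_of_sq_lt hp hx0 (by nlinarith)
  have hyp : IsCoprime y p := isCoprime_of_sq_lt hp hy0 (by nlinarith)
  have hcp : IsCoprime c p := isCoprime_of_sq_lt hp hc0 (by nlinarith)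
  have hQp : IsCoprime Q p := by
    rw [isCoprime_comm, (Nat.prime_iff_prime_int.1 hp).irreducible.coprime_iff_not_dvd]
    intro h
    have := Int.le_of_dvd hQ0 h
    nlinarith
  have hcd' : IsCoprime c d := by
    have : IsCoprime c (d ^ 2) := isCoprime_of_eq_add hcp (z := -c) (by rw [hcd]; ring)
    exact (IsCoprime.pow_right_iff two_pos).1 this
  have hxQy : IsCoprime x (2 * Q * y ^ 2) := isCoprime_of_eq_add hxp (z := -x) (by rw [hxy]; ring)
  have hxQ : IsCoprime x Q := hxQy.of_mul_right_left.of_mul_right_right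
  have hxy' : IsCoprime x y := (IsCoprime.pow_right_iff two_pos).1 hxQy.of_mul_right_right
  -- This polynomial in t is h for v = 8xt. A prime dividing its coefficients and Qyp is odd and
  -- prime to x, so it divides x + d and x − d, hence 2x, which is impossible.
  obtain ⟨t, ht⟩ := exists_isCoprime_quadratic (A := x + d) (B := 16 * x * c)
    (C := 64 * x ^ 2 * (x - d)) (M := Q * y * p)
    ⟨2 * (X + D), by rw [hx, hd]; ring⟩ (mul_ne_zero (mul_ne_zero hQ0.ne' hy0) hp0) (by
      intro l hl hM h1 h2 h3
      have hlp := Nat.prime_iff_prime_int.1 hl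
      have hx' : ¬ (l : ℤ) ∣ x := fun h =>
        hlp.not_isUnit (((hxQ.mul_right hxy').mul_right hxp).isUnit_of_dvd' h hM)
      have hl2 : ¬ (l : ℤ) ∣ 2 := fun h => by
        have h4 : (l : ℤ) ∣ 1 := by
          have := dvd_sub h1 (h.mul_right (2 * (X + D)))
          rwa [show x + d - 2 * (2 * (X + D)) = 1 by rw [hx, hd]; ring] at this
        exact hlp.not_isUnit (isUnit_of_dvd_one h4)
      have h64 : ¬ (l : ℤ) ∣ 64 := fun h => hl2 (hlp.dvd_of_dvd_pow (n := 6) (by norm_num; exact h))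
      have h5 : (l : ℤ) ∣ x - d := by
        rcases hlp.dvd_or_dvd h3 with h | h
        · rcases hlp.dvd_or_dvd h with h | h
          · exact absurd h h64
          · exact absurd (hlp.dvd_of_dvd_pow h) hx'
        · exact h
      have h6 : (l : ℤ) ∣ 2 * x := by
        have := dvd_add h1 h5
        rwa [show x + d + (x - d) = 2 * x by ring] at this
      exact (hlp.dvd_or_dvd h6).elim hl2 hx')
  obtain ⟨v, hv⟩ : ∃ v, v = 8 * (x * t) := ⟨_, rfl⟩
  obtain ⟨h, hh⟩ : ∃ h, h = x + d + 2 * v * c + v ^ 2 * (x - d) := ⟨_, rfl⟩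
  have hht : x + d + 16 * x * c * t + 64 * x ^ 2 * (x - d) * t ^ 2 = h := by rw [hh, hv]; ring
  rw [hht] at ht
  obtain ⟨V, hV⟩ : ∃ V, V = x * t := ⟨_, rfl⟩
  obtain ⟨g₁, hg₁⟩ : ∃ g, g = 1 + 2 * X + 2 * C + 2 * D + 4 * V * (c + x - d) := ⟨_, rfl⟩
  obtain ⟨g₂, hg₂⟩ : ∃ g, g = 2 * C - 2 * X - 2 * D + 4 * V * (x - d - c) := ⟨_, rfl⟩
  have hg₁' : 2 * g₁ = (x + d + v * c) + (c + v * x - v * d) := by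
    rw [hg₁, hv, ← hV]; linear_combination -hx - hc - hd
  have hg₂' : 2 * g₂ = (c + v * x - v * d) - (x + d + v * c) := by
    rw [hg₂, hv, ← hV]; linear_combination hx - hc + hd
  obtain ⟨ho, him, cQγ, key⟩ := auxiliary_identity (t := 8 * t) (V := V) hcd hxy hx hc hd hy hQ
    (by rw [hv]; ring) (by rw [hv, hV]) hh hg₁' hg₂' hy0 hxQ hxy' hyp
    ht.of_mul_right_left.of_mul_right_left ht.of_mul_right_left.of_mul_right_right
    ht.of_mul_right_right hcd' hxp
  obtain ⟨γ₁, hγ₁⟩ : ∃ γ₁ : GaussianInt, γ₁ = ⟨g₁, g₂⟩ := ⟨_, rfl⟩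
  obtain ⟨s, hs⟩ : ∃ s : GaussianInt, s = ⟨1, v⟩ := ⟨_, rfl⟩
  obtain ⟨π, hπ⟩ : ∃ π : GaussianInt, π = ⟨d, c⟩ := ⟨_, rfl⟩
  obtain ⟨β, hβ⟩ : ∃ β : GaussianInt, β = ⟨b, a⟩ := ⟨_, rfl⟩
  obtain ⟨γ, hγ⟩ : ∃ γ : GaussianInt, γ = ⟨x + d + v * c, c + v * x - v * d⟩ := ⟨_, rfl⟩
  rw [← hγ₁] at ho cQγ key
  rw [← hπ, ← hβ]
  have rγ : γ = (1 + gaussI) * γ₁ := by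
    rw [hγ, hγ₁]
    ext
    · simp; linarith
    · simp; linarith
  have rγs : γ = s * x + star s * π := by
    rw [hγ, hs, hπ]; ext <;> simp <;> ring
  have rγs' : star γ = star s * x + s * star π := by
    rw [rγs, star_add, star_mul', star_mul', star_star, star_intCast]
  have rππ : π * star π = ((p : ℤ) : GaussianInt) := by
    rw [hπ, hcd]; ext
    · simp [pow_two]; ring
    · simp [pow_two]; ring
  have rβ : β * star β = (Q : GaussianInt) := by
    rw [hβ, hQd]; ext
    · simp [pow_two]; ring
    · simp [pow_two]; ring
  have rp : ((p : ℤ) : GaussianInt) = x ^ 2 + 2 * Q * y ^ 2 := by rw [hxy]; push_cast; ring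
  have hβN : β.norm = Q := by rw [norm_eq, hβ, hQd]; ring
  have hβo : Odd β.norm := by rw [hβN]; exact odd_of_eq hQ
  have hβo' : Odd (star β).norm := by rwa [Zsqrtd.norm_conj]
  have hQo := odd_norm_intCast (odd_of_eq hQ)
  have cxβ : IsCoprime (x : GaussianInt) β := by
    have := isCoprime_intCast hxQ
    rw [← rβ] at this
    exact this.of_mul_right_left
  have cpβ : IsCoprime ((p : ℤ) : GaussianInt) β := by
    have := isCoprime_intCast hQp.symm
    rw [← rβ] at this
    exact this.of_mul_right_left
  rw [← rππ] at cpβ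
  have cπβ := cpβ.of_mul_left_left
  have cγ : IsCoprime (star γ) β := by
    have h1 : IsCoprime γ (Q : GaussianInt) := by
      rw [rγ]; exact (isCoprime_one_add_gaussI hQo).mul_left cQγ.symm
    rw [← rβ] at h1
    have := h1.of_mul_right_right.map (starRingEnd GaussianInt)
    rwa [starRingEnd_apply, starRingEnd_apply, star_star] at this
  refine ⟨hcd', hy0, hxp, hyp, cxβ, cπβ, ?_⟩
  have k1 : Jac γ Q = I ^ q * Jac Q γ₁ := by
    rw [rγ, jacobi_mul_left hQo, jacobi_one_add_gaussI hQ,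
      reciprocity ho (by rw [hγ₁]; exact him) (by omega) cQγ.symm]
  -- Factor Q = ββ̄ and conjugate the symbol modulo β̄.
  have k2 : Jac γ Q = Jac γ β * star (Jac (star γ) β) := by
    rw [← rβ, jacobi_mul_right (odd_norm_ne_zero hβo) (odd_norm_ne_zero hβo'),
      ← jacobi_star hβo (star γ), star_star]
  have k3 := jacobi_mul_star hβo cγ
  have k4 : Jac γ β * Jac (star π) β = Jac x β * Jac (star γ) β := by
    rw [← jacobi_mul_left hβo, ← jacobi_mul_left hβo]
    apply jacobi_congr hβo
    refine ⟨2 * star s * y ^ 2 * star β, ?_⟩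
    rw [rγs', rγs]
    linear_combination star s * rππ + star s * rp - 2 * star s * y ^ 2 * rβ
  have k5 : Jac π β * Jac (star π) β = Jac x β * Jac x β := by
    rw [← jacobi_mul_left hβo, ← jacobi_mul_left hβo]
    apply jacobi_congr hβo
    refine ⟨2 * y ^ 2 * star β, ?_⟩
    linear_combination rππ + rp - 2 * y ^ 2 * rβ
  have hxβ0 := jacobi_ne_zero hβo cxβ
  -- Combining γπ̄ ≡ xγ̄ modulo β with the factorization of (γ/Q) gives (γ/Q)(π̄/β) = (x/β); then
  -- ππ̄ ≡ x² modulo β eliminates π̄.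
  have k6 : Jac π β = Jac γ Q * Jac x β := by
    have e1 : Jac γ Q * Jac (star π) β = Jac x β := by
      rw [k2]
      linear_combination star (Jac (star γ) β) * k4 + Jac x β * k3
    apply mul_left_cancel₀ hxβ0
    linear_combination (-Jac π β) * e1 + Jac γ Q * k5
  rw [k6, k1, show q + 3 * D + 2 * X = q + (3 * D + 2 * X) by ring, zpow_add₀ hI0]
  linear_combination (I ^ q * Jac x β) * key

/-! ### Transfer to powers of c/d modulo p -/

theorem zpow_eq_zpow_iff {K : Type*} [Field K] {w : K} (h : w ^ 2 = -1) (h2 : (2 : K) ≠ 0)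
    (m n : ℤ) : w ^ m = w ^ n ↔ m ≡ n [ZMOD 4] := by
  have h1 : (-1 : K) ≠ 1 := fun h' => h2 (by linear_combination -h')
  have hw0 : w ≠ 0 := by rintro rfl; rw [zero_pow two_ne_zero] at h; exact absurd h (by simp)
  have h4 : w ^ 4 = 1 := by rw [show 4 = 2 * 2 from rfl, pow_mul, h]; norm_num
  have key : ∀ k : ℤ, w ^ k = 1 ↔ 4 ∣ k := by
    intro k
    have hk : w ^ k = w ^ (k % 4) := by
      conv_lhs => rw [← Int.mul_ediv_add_emod k 4, zpow_add₀ hw0, zpow_mul]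
      rw [show (4 : ℤ) = (4 : ℕ) from rfl, zpow_natCast, h4, one_zpow, one_mul]
    rw [hk, Int.dvd_iff_emod_eq_zero]
    have hl := Int.emod_nonneg k (show (4 : ℤ) ≠ 0 by norm_num)
    have hu := Int.emod_lt_of_pos k (show (0 : ℤ) < 4 by norm_num)
    generalize k % 4 = l at *
    interval_cases l
    · simp
    · simp only [zpow_one, one_ne_zero, iff_false]
      rintro rfl
      exact h1 (by rw [← h, one_pow])
    · rw [show (2 : ℤ) = (2 : ℕ) from rfl, zpow_natCast, h]
      simpa using h1
    · rw [show (3 : ℤ) = (3 : ℕ) from rfl, zpow_natCast, pow_succ, h]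
      simp only [neg_mul, one_mul, Nat.cast_ofNat, OfNat.ofNat_ne_zero, iff_false]
      intro h3
      have : w = -1 := by rw [← h3, neg_neg]
      rw [this] at h
      exact h1 (by rw [← h]; norm_num)
  rw [← div_eq_one_iff_eq (zpow_ne_zero n hw0), ← zpow_sub₀ hw0, key, Int.modEq_comm,
    Int.modEq_iff_dvd]

/-- The reduced denominator divides x, hence is prime to β, so both denominators have nonzero
symbols and one may cross-multiply. -/
theorem jacobiSymbolRat_div {β : GaussianInt} (ho : Odd β.norm) (N x : ℤ) (hx : x ≠ 0)
    (hc : IsCoprime (x : GaussianInt) β) :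
    quarticJacobiSymbolRat ((N : ℚ) / x) β = Jac N β / Jac x β := by
  obtain ⟨t, ht⟩ : ∃ t : ℚ, t = (N : ℚ) / x := ⟨_, rfl⟩
  rw [← ht, quarticJacobiSymbolRat]
  have hxq : (x : ℚ) ≠ 0 := by exact_mod_cast hx
  have hdq : (t.den : ℚ) ≠ 0 := by exact_mod_cast t.den_ne_zero
  have h1 : t.num * x = N * t.den := by
    rw [← Rat.num_div_den t, div_eq_div_iff hdq hxq] at ht
    exact_mod_cast ht
  have h2 : (t.den : ℤ) ∣ x := by
    have : IsCoprime (t.den : ℤ) t.num := by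
      rw [Int.isCoprime_iff_gcd_eq_one, Int.gcd_comm]
      exact t.reduced
    exact this.dvd_of_dvd_mul_left ⟨N, by rw [h1, mul_comm]⟩
  have hdc : IsCoprime ((t.den : ℤ) : GaussianInt) β :=
    hc.of_isCoprime_of_dvd_left (map_dvd (Int.castRingHom GaussianInt) h2)
  rw [Int.cast_natCast] at hdc
  rw [div_eq_div_iff (jacobi_ne_zero ho hdc) (jacobi_ne_zero ho hc), ← jacobi_mul_left ho,
    ← jacobi_mul_left ho]
  congr 1
  exact_mod_cast congrArg (Int.cast : ℤ → GaussianInt) h1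

/-- The residue `(-a² - b²) ^ ((p - 1) / 8)` is a power of the square root `c / d` of `-1`
whose exponent is determined by the quartic symbol of `(a c + b d) / x`. -/
theorem exists_zpow_eq {p : ℕ} [Fact p.Prime] {a b c d x y X C D Y q : ℤ}
    (hcd : (p : ℤ) = c ^ 2 + d ^ 2) (hxy : (p : ℤ) = x ^ 2 + 2 * (a ^ 2 + b ^ 2) * y ^ 2)
    (hx : x = 4 * X + 1) (hc : c = 4 * C + 1) (hd : d = 4 * D) (hy : y = 2 * Y)
    (ha0 : a ≠ 0) (hQ : a ^ 2 + b ^ 2 = 4 * q + 1) :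
    ((c : ZMod p) / d) ^ 2 = -1 ∧ (2 : ZMod p) ≠ 0 ∧
    IsCoprime (x : GaussianInt) (⟨b, a⟩ : GaussianInt) ∧
    ∃ A : ℤ, (-(a : ZMod p) ^ 2 - (b : ZMod p) ^ 2) ^ ((p - 1) / 8) = ((c : ZMod p) / d) ^ A ∧
      I ^ A * Jac a ⟨b, a⟩ =
        I ^ (2 * (D + Y)) * (Jac ((a * c + b * d : ℤ) : GaussianInt) ⟨b, a⟩ / Jac x ⟨b, a⟩) := by
  have hI0 := Complex.I_ne_zero
  have hp := (Fact.out : p.Prime)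
  obtain ⟨hcd', hy0, hxp, hyp, cxβ, cπβ, key⟩ := symbol_identity hp hcd hxy hx hc hd hy ha0 hQ
  obtain ⟨ϖ, hϖ⟩ : ∃ ϖ : GaussianInt, ϖ = ⟨c, -d⟩ := ⟨_, rfl⟩
  obtain ⟨β, hβ⟩ : ∃ β : GaussianInt, β = ⟨b, a⟩ := ⟨_, rfl⟩
  have hN : ϖ.norm = p := by rw [norm_eq, hϖ, hcd]; ring
  have hpe : (p : ℤ) = 8 * (2 * C ^ 2 + C + 2 * D ^ 2) + 1 := by rw [hcd, hc, hd]; ring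
  have hϖo : Odd ϖ.norm := by
    rw [hN]; exact odd_of_eq (k := 2 * (2 * C ^ 2 + C + 2 * D ^ 2)) (by rw [hpe]; ring)
  have hϖp := prime_of_norm_prime hp hN
  have hβN : β.norm = 4 * q + 1 := by rw [norm_eq, hβ, ← hQ]; ring
  have hβo : Odd β.norm := by rw [hβN]; exact odd_of_eq rfl
  have hzcd : (c : ZMod p) ^ 2 + (d : ZMod p) ^ 2 = 0 := by
    have := congrArg (Int.cast : ℤ → ZMod p) hcd
    push_cast at this
    rw [← this, ZMod.natCast_self]
  have hzxy : (x : ZMod p) ^ 2 + 2 * ((a : ZMod p) ^ 2 + (b : ZMod p) ^ 2) * (y : ZMod p) ^ 2 = 0 := by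
    have := congrArg (Int.cast : ℤ → ZMod p) hxy
    push_cast at this
    rw [← this, ZMod.natCast_self]
  have hzne : ∀ {z : ℤ}, IsCoprime z p → (z : ZMod p) ≠ 0 := fun {z} hz h => by
    rw [ZMod.intCast_zmod_eq_zero_iff_dvd] at h
    exact (Nat.prime_iff_prime_int.1 hp).not_isUnit (hz.isUnit_of_dvd' h dvd_rfl)
  have hz2 : (2 : ZMod p) ≠ 0 := by
    have : IsCoprime (2 : ℤ) p := ⟨-(4 * (2 * C ^ 2 + C + 2 * D ^ 2)), 1, by rw [hpe]; ring⟩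
    simpa using hzne this
  have hzd : (d : ZMod p) ≠ 0 := by
    refine hzne ?_
    refine isCoprime_of_eq_add (b := c ^ 2) (z := d) (IsCoprime.pow_right hcd'.symm) ?_
    rw [hcd]; ring
  obtain ⟨w, hw⟩ : ∃ w : ZMod p, w = (c : ZMod p) / d := ⟨_, rfl⟩
  have hw2 : w ^ 2 = -1 := by
    rw [hw]; field_simp; linear_combination hzcd
  have hw0 : w ≠ 0 := by
    rintro rfl; rw [zero_pow two_ne_zero] at hw2; exact absurd hw2 (by simp)
  rw [← hw]
  refine ⟨hw2, hz2, cxβ, ?_⟩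
  rw [← hϖ, ← hβ] at key
  rw [← hβ] at cxβ cπβ ⊢
  -- Sending i to w = c/d kills c − di, so f is reduction modulo ϖ.
  obtain ⟨f, hf⟩ : ∃ f, f = homOfSq w (by rw [← sq, hw2]) := ⟨_, rfl⟩
  have hfϖ : f ϖ = 0 := by
    rw [hf, homOfSq_apply, hϖ, hw]; push_cast; field_simp; ring
  have hfI : f gaussI = w := by rw [hf, homOfSq_apply]; simp
  have hk : ∀ {α : GaussianInt}, f α ≠ 0 → ∃ k : ℕ, Jac α ϖ = I ^ k ∧
      f α ^ ((p - 1) / 4) = w ^ k := fun {α} hα => by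
    obtain ⟨k, h1, h2⟩ := exists_residueSymbol_hom f hϖp hϖo hfϖ hα
    rw [hN, Int.natAbs_natCast, map_pow, hfI] at h2
    exact ⟨k, by rw [jacobi_prime hϖp, h1], h2⟩
  have hfx : f x = (x : ZMod p) := map_intCast _ _
  have hfy : f y = (y : ZMod p) := map_intCast _ _
  have hzx := hzne hxp
  have hzy := hzne hyp
  have hf1 : f (1 + gaussI) = 1 + w := by rw [map_add, map_one, hfI]
  have hz1 : 1 + w ≠ 0 := fun h => hz2 (by
    have : w = -1 := by linear_combination h
    rw [this] at hw2
    linear_combination hw2)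
  obtain ⟨kx, hkx, hkx'⟩ := hk (α := x) (by rwa [hfx])
  obtain ⟨ky, hky, hky'⟩ := hk (α := y) (by rwa [hfy])
  obtain ⟨k₁, hk₁, hk₁'⟩ := hk (α := 1 + gaussI) (by rwa [hf1])
  rw [hfx] at hkx'
  rw [hfy] at hky'
  rw [hf1] at hk₁'
  have hsupp : I ^ (k₁ : ℤ) = I ^ (C + D) := by
    rw [zpow_natCast, ← hk₁, hϖ, jacobi_one_add_gaussI_primary hc (l := -D) (by omega) hcd'.neg_right]
    rw [sub_neg_eq_add]
  -- Since (1+w)² = 2w, the right side is x²/(2y²), which is −(a² + b²) in `ZMod p`.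
  have hbase : -(a : ZMod p) ^ 2 - (b : ZMod p) ^ 2 = w * ((x : ZMod p) / ((1 + w) * y)) ^ 2 := by
    have hden : ((1 + w) * (y : ZMod p)) ^ 2 ≠ 0 := pow_ne_zero _ (mul_ne_zero hz1 hzy)
    rw [div_pow, ← mul_div_assoc, eq_div_iff hden]
    linear_combination (-w) * hzxy + (-((a : ZMod p) ^ 2 + (b : ZMod p) ^ 2) * y ^ 2) * hw2
  obtain ⟨P, hP⟩ : ∃ P : ℕ, (P : ℤ) = 2 * C ^ 2 + C + 2 * D ^ 2 :=
    ⟨(2 * C ^ 2 + C + 2 * D ^ 2).toNat, Int.toNat_of_nonneg (by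
      have := hp.pos; omega)⟩
  have hp8 : (p - 1) / 8 = P := by omega
  have hp4 : (p - 1) / 4 = 2 * P := by omega
  refine ⟨P + kx - (k₁ + ky), ?_, ?_⟩
  · rw [hp8, hbase, mul_pow, ← pow_mul, ← hp4, div_pow, mul_pow, hkx', hky', hk₁',
      zpow_sub₀ hw0, zpow_add₀ hw0, zpow_add₀ hw0, zpow_natCast, zpow_natCast, zpow_natCast,
      zpow_natCast, mul_div_assoc]
  -- Modulo b + ai one has b ≡ −ai, so ac + bd ≡ a(c − di) = −ia(d + ci).
  · have hnum : Jac ((a * c + b * d : ℤ) : GaussianInt) β =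
        Jac a β * (I ^ (2 * q) * I ^ q * Jac ⟨d, c⟩ β) := by
      rw [← jacobi_neg_one' hβo hβN, ← jacobi_gaussI hβo hβN, ← jacobi_mul_left hβo,
        ← jacobi_mul_left hβo, ← jacobi_mul_left hβo]
      apply jacobi_congr hβo
      refine ⟨d, ?_⟩
      rw [hβ, mk_eq, mk_eq]
      push_cast
      linear_combination (a : GaussianInt) * c * gaussI_sq
    have hx0 := jacobi_ne_zero hβo cxβ
    have hIy : I ^ (ky : ℤ) ≠ 0 := zpow_ne_zero _ hI0
    rw [hkx, hky, ← zpow_natCast, ← zpow_natCast] at key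
    rw [hnum, zpow_sub₀ hI0, zpow_add₀ hI0, zpow_add₀ hI0, hsupp, ← mul_div_assoc, div_mul_eq_mul_div,
      div_eq_div_iff (mul_ne_zero (zpow_ne_zero _ hI0) hIy) hx0]
    -- P = (p−1)/8 is computed from both representations of p; the evenness of n(n−1) for n = C, D,
    -- Y removes the quadratic terms modulo 4.
    have hexp : I ^ (P : ℤ) = I ^ (2 * (D + Y)) * I ^ (2 * q) * I ^ q * I ^ (C + D) *
        I ^ (q + 3 * D + 2 * X) := by
      rw [← zpow_add₀ hI0, ← zpow_add₀ hI0, ← zpow_add₀ hI0, ← zpow_add₀ hI0]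
      obtain ⟨m, hm⟩ : ∃ m, Y * (Y - 1) = 2 * m := (Int.even_mul_pred_self Y).two_dvd
      obtain ⟨n, hn⟩ : ∃ n, C * (C - 1) = 2 * n := (Int.even_mul_pred_self C).two_dvd
      obtain ⟨k, hk⟩ : ∃ k, D * (D - 1) = 2 * k := (Int.even_mul_pred_self D).two_dvd
      have e1 : 2 * C ^ 2 + C + 2 * D ^ 2 = 2 * X ^ 2 + X + (4 * q + 1) * Y ^ 2 := by
        have : 8 * (2 * C ^ 2 + C + 2 * D ^ 2) = 8 * (2 * X ^ 2 + X + (4 * q + 1) * Y ^ 2) := by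
          rw [hpe, hQ, hx, hy] at hxy
          linear_combination hxy
        linarith
      rw [hP]
      apply I_zpow_congr
      rw [Int.modEq_iff_dvd]
      refine ⟨D + q - n - k - m - 2 * q * Y ^ 2 - X ^ 2 + C ^ 2 + D ^ 2, ?_⟩
      linear_combination -2 * hn - 2 * hk - 2 * hm - 2 * e1
    linear_combination (Jac a β * I ^ (kx : ℤ) * Jac x β) * hexp -
      (I ^ (2 * (D + Y)) * Jac a β * I ^ (2 * q) * I ^ q * I ^ (C + D)) * key

/-! ### Comparison of exponents modulo 4 -/

theorem eq_iff_of_exponents {K : Type*} [Field K] {w g : K} (hw : w ^ 2 = -1) (h2 : (2 : K) ≠ 0)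
    {R : ℂ} {A j n N T m : ℤ} (hg : g = w ^ A) (hR : I ^ A * I ^ j = I ^ n * R)
    (hT : 2 * N + T ≡ n - j + m [ZMOD 4]) : g = (-1) ^ N * w ^ T ↔ R = I ^ m := by
  have hw0 : w ≠ 0 := by
    rintro rfl; rw [zero_pow two_ne_zero] at hw; exact absurd hw (by simp)
  have hI0 := Complex.I_ne_zero
  have hR' : R = I ^ (A + j - n) := by
    rw [zpow_sub₀ hI0, zpow_add₀ hI0, hR, mul_div_cancel_left₀ _ (zpow_ne_zero _ hI0)]
  -- Replacing −1 by w² leaves equalities between powers of w and between powers of i, each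
  -- equivalent to a congruence of exponents modulo 4.
  rw [hg, hR', ← hw, ← zpow_natCast, ← zpow_mul, ← zpow_add₀ hw0, zpow_eq_zpow_iff hw h2,
    zpow_eq_zpow_iff Complex.I_sq two_ne_zero]
  simp only [Int.modEq_iff_dvd, Nat.cast_ofNat] at hT ⊢
  omega

theorem even_of_eq_one_mod_eight {X e q y : ℤ} (hX : Odd X)
    (h : 8 * e + 1 = X ^ 2 + 2 * (4 * q + 1) * y ^ 2) : Even y := by
  obtain ⟨k, hk⟩ := hX
  obtain ⟨m, hm⟩ := Int.even_mul_succ_self k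
  by_contra hy
  obtain ⟨l, hl⟩ := Int.not_even_iff_odd.1 hy
  have : 8 * e = 8 * m + 2 * (4 * q + 1) * (4 * (l ^ 2 + l) + 1) := by
    rw [hk, hl] at h; linear_combination h + 4 * hm
  have h3 : 8 * (e - m - (4 * q + 1) * (l ^ 2 + l) - q) = 2 := by linear_combination this
  omega

end QuarticSymbol

open QuarticSymbol in
theorem theorem4p7 (p : ℕ) [Fact p.Prime] (hp : p ≡ 1 [MOD 8])
    (a b c d x y : ℤ) (hcd : (p : ℤ) = c ^ 2 + d ^ 2)
    (hxy : (p : ℤ) = x ^ 2 + 2 * (a ^ 2 + b ^ 2) * y ^ 2)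
    (ha0 : a ≠ 0) (ha2 : 2 ∣ a) (hab : Int.gcd a b = 1)
    (hc : c ≡ 1 [ZMOD 4])
    (r : ℕ) (d₀ : ℤ) (hd : d = 2 ^ r * d₀) (hd₀ : d₀ ≡ 1 [ZMOD 4])
    (hgcd : Int.gcd c (x + d) = 1 ∨ Int.gcd d₀ (x + c) = 1) (m : ℤ) :
    (4 ∣ a →
      ((-(a : ZMod p) ^ 2 - (b : ZMod p) ^ 2) ^ ((p - 1) / 8) =
          (-1) ^ (d / 4 + y / 2) * ((c : ZMod p) / (d : ZMod p)) ^ m ↔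
        quarticJacobiSymbolRat ((a * c + b * d : ℚ) / x) ⟨b, a⟩ = Complex.I ^ m)) ∧
    (4 ∣ a - 2 →
      ((-(a : ZMod p) ^ 2 - (b : ZMod p) ^ 2) ^ ((p - 1) / 8) =
          (-1) ^ ((b - 1) / 2 + d / 4 + y / 2 + (x - 1) / 2) *
            ((c : ZMod p) / (d : ZMod p)) ^ (m - 1) ↔
        quarticJacobiSymbolRat ((a * c + b * d : ℚ) / x) ⟨b, a⟩ = Complex.I ^ m)) := by
  have hI0 := Complex.I_ne_zero
  obtain ⟨e, he⟩ : ∃ e : ℤ, (p : ℤ) = 8 * e + 1 := ⟨p / 8, by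
    have : p % 8 = 1 := hp
    omega⟩
  obtain ⟨A, rfl⟩ := ha2
  have hb : Odd b := by
    by_contra h
    obtain ⟨k, rfl⟩ := (Int.not_odd_iff_even.1 h).two_dvd
    rw [Int.gcd_mul_left] at hab
    exact absurd (Nat.dvd_one.1 ⟨_, hab.symm⟩) (by decide)
  obtain ⟨B, rfl⟩ := hb
  obtain ⟨B', hB'⟩ := (Int.even_mul_succ_self B).two_dvd
  obtain ⟨q, hq⟩ : ∃ q, q = A ^ 2 + 2 * B' := ⟨_, rfl⟩
  have hQ : (2 * A) ^ 2 + (2 * B + 1) ^ 2 = 4 * q + 1 := by rw [hq]; linear_combination 4 * hB'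
  have hxo : Odd x := by
    rw [← Int.not_even_iff_odd]
    rintro ⟨k, rfl⟩
    have : (2 : ℤ) ∣ 1 := ⟨2 * k ^ 2 + ((2 * A) ^ 2 + (2 * B + 1) ^ 2) * y ^ 2 - 4 * e, by
      linear_combination hxy - he⟩
    omega
  obtain ⟨Y, rfl⟩ := (even_of_eq_one_mod_eight hxo (by rw [← he, hxy, hQ])).two_dvd
  obtain ⟨C, rfl⟩ : ∃ C, c = 4 * C + 1 := ⟨c / 4, by have : c % 4 = 1 := hc; omega⟩
  obtain ⟨D, rfl⟩ : 4 ∣ d := by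
    have hd2 : d ^ 2 = 8 * (e - 2 * C ^ 2 - C) := by linear_combination he - hcd
    obtain ⟨k, rfl⟩ : Even d := by
      by_contra h
      have := (Int.not_even_iff_odd.1 h).pow (n := 2)
      rw [hd2, ← Int.not_even_iff_odd] at this
      exact this ((show Even (8 : ℤ) from ⟨4, rfl⟩).mul_right _)
    have hk2 : Even (k ^ 2) := ⟨e - 2 * C ^ 2 - C, by linarith⟩
    obtain ⟨l, rfl⟩ := (Int.even_pow.1 hk2).1
    exact ⟨l, by ring⟩
  -- The symbol identities need x ≡ 1 (mod 4), so x is replaced by x' = ±x; only the square of x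
  -- enters the representation of p.
  obtain ⟨x', X, hx', hσ⟩ : ∃ x' X : ℤ, x' = 4 * X + 1 ∧ (x = x' ∨ x = -x') := by
    obtain ⟨k, rfl⟩ := hxo
    rcases Int.even_or_odd' k with ⟨l, rfl | rfl⟩
    · exact ⟨_, l, rfl, Or.inl (by ring)⟩
    · exact ⟨_, -l - 1, rfl, Or.inr (by ring)⟩
  have hx2 : x ^ 2 = x' ^ 2 := by rcases hσ with rfl | rfl <;> ring
  obtain ⟨hw2, h2, hcop, E, hE, hR⟩ := exists_zpow_eq (Y := Y) hcd (by rw [hxy, hx2]) hx' rfl rfl rfl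
    ha0 hQ
  obtain ⟨β, hβ⟩ : ∃ β : GaussianInt, β = ⟨2 * B + 1, 2 * A⟩ := ⟨_, rfl⟩
  have hβN : β.norm = 4 * q + 1 := by rw [norm_eq, hβ, ← hQ]; ring
  have hβo : Odd β.norm := by rw [hβN]; exact odd_of_eq rfl
  have him := jacobi_im (even_two_mul A) (Int.isCoprime_iff_gcd_eq_one.2 hab)
  have hx0 : x' ≠ 0 := by omega
  rw [← hβ] at hcop hR him ⊢
  obtain ⟨N, hN⟩ : ∃ N : ℤ, N = 2 * A * (4 * C + 1) + (2 * B + 1) * (4 * D) := ⟨_, rfl⟩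
  have hNq : ((2 * A : ℤ) * (4 * C + 1 : ℤ) + (2 * B + 1 : ℤ) * (4 * D : ℤ) : ℚ) = N := by
    rw [hN]; push_cast; ring
  rw [← hN] at hR
  rw [hNq]
  -- Restoring the sign of x costs (−1/β) = i^(2q) when x = −x'. The divisibility covers both signs,
  -- and the parity of q, which is that of a/2, decides whether (x−1)/2 enters the final exponent.
  obtain ⟨s, hs, hs'⟩ : ∃ s : ℤ, quarticJacobiSymbolRat ((N : ℚ) / x) β =
      Complex.I ^ s * (quarticJacobiSymbol N β / quarticJacobiSymbol x' β) ∧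
      4 ∣ s - 2 * q * ((x - 1) / 2) := by
    rcases hσ with rfl | rfl
    · refine ⟨0, ?_, ?_⟩
      · rw [← jacobiSymbolRat_div hβo _ _ hx0 hcop, zpow_zero, one_mul]
      · rw [hx', show (4 * X + 1 - 1) / 2 = 2 * X by omega]
        exact ⟨-(q * X), by ring⟩
    · refine ⟨2 * q, ?_, ?_⟩
      · rw [Int.cast_neg, div_neg, ← neg_div, ← Int.cast_neg, jacobiSymbolRat_div hβo _ _ hx0 hcop,
          mul_div_assoc', ← jacobi_neg_one' hβo hβN, ← jacobi_mul_left hβo, neg_one_mul, Int.cast_neg]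
      · rw [hx', show (-(4 * X + 1) - 1) / 2 = -2 * X - 1 by omega]
        exact ⟨q * (X + 1), by ring⟩
  have hm1 : ∀ k : ℤ, ((-1 : ℂ)) ^ k = Complex.I ^ (2 * k) := fun k => by
    rw [← Complex.I_sq, ← zpow_natCast, ← zpow_mul, Nat.cast_ofNat]
  have hRs : ∀ n, Complex.I ^ n * (quarticJacobiSymbol N β / quarticJacobiSymbol x' β) =
      Complex.I ^ (n - s) * quarticJacobiSymbolRat ((N : ℚ) / x) β := fun n => by
    rw [hs, ← mul_assoc, ← zpow_add₀ hI0, sub_add_cancel]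
  rw [hRs] at hR
  rw [show 4 * D / 4 = D by omega, show 2 * Y / 2 = Y by omega,
    show (2 * B + 1 - 1) / 2 = B by omega]
  rw [show (2 * B + 1 - 1) / 2 = B by omega] at him
  constructor
  · intro h4
    rw [him.1 h4] at hR
    refine eq_iff_of_exponents (j := 0) (n := 2 * (D + Y) - s) hw2 h2 hE (by rw [zpow_zero]; exact hR) ?_
    obtain ⟨A', rfl⟩ : 2 ∣ A := by omega
    obtain ⟨u, hu⟩ : ∃ u, s = 4 * u := by
      obtain ⟨t, ht⟩ := hs'
      exact ⟨t + (2 * A' ^ 2 + B') * ((x - 1) / 2), by rw [hq] at ht; linear_combination ht⟩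
    rw [Int.modEq_iff_dvd]
    omega
  · intro h4
    rw [him.2 h4, hm1] at hR
    refine eq_iff_of_exponents (j := 1 + 2 * B) (n := 2 * (D + Y) - s) hw2 h2 hE
      (by rw [zpow_add₀ hI0, zpow_one]; exact hR) ?_
    obtain ⟨A', rfl⟩ : ∃ A', A = 2 * A' + 1 := ⟨A / 2, by omega⟩
    obtain ⟨u, hu⟩ : ∃ u, s = 4 * u + 2 * ((x - 1) / 2) := by
      obtain ⟨t, ht⟩ := hs'
      exact ⟨t + (2 * A' ^ 2 + 2 * A' + B') * ((x - 1) / 2), by rw [hq] at ht; linear_combination ht⟩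
    rw [Int.modEq_iff_dvd]
    omega
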